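/- Let $x>0$ and $\beta>1$. For $\lambda>\mu>0$ consider a particle that moves on $[0,\infty)$ with velocities $\pm1$, starts at $x$ going upwards, and alternates upward phases with exponential durations of rate $\lambda$ and downward phases with exponential durations of rate $\mu$, all the durations being independent. At each visit to the origin it is either absorbed or sent upwards again, after which it moves in the same way with fresh independent durations; it is absorbed at its $M$-th visit, where $M$ is independent of all the durations. Thus its absorption time at the origin is $$A_x(\lambda,\mu)=C_x+1_{\{M>1\}}\sum_{i=1}^{M-1}C_{0,i},$$ where $C_x$ is the time of the first arrival at the origin, $C_{0,i}$ is the time between the $i$-th and the $(i+1)$-th visit to the origin, and $C_x,M,C_{0,1},C_{0,2},\dots$ are independent. Here $M$ is a positive integer valued random variable, not depending on $\lambda,\mu$, such that $\mathbb E[e^{sM}]<\infty$ for some $s>0$. Let $$\Lambda(s;\lambda,\mu)=\frac{\lambda-\mu-\sqrt{(\lambda+\mu-2s)^2-4\lambda\mu}}{2},$$ and let $\Lambda''$ denote its second derivative with respect to $s$. Suppose that, for every $\mu>0$, $A_x(\beta\mu,\mu)$ is the absorption time with $\lambda=\beta\mu$, all these random variables being defined on the same probability space. Then $A_x(\beta\mu,\mu)$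 is integrable for every $\mu>0$, and, for every family of positive numbers $\{\varepsilon_\mu:\mu>0\}$ such that $\varepsilon_\mu\to0$ and $\mu\varepsilon_\mu\to\infty$ as $\mu\to\infty$, the random variables $$Z_\mu=\sqrt{\mu\varepsilon_\mu}\,\bigl(A_x(\beta\mu,\mu)-\mathbb E[A_x(\beta\mu,\mu)]\bigr)$$ satisfy, as $\mu\to\infty$, the large deviation principle on $\mathbb R$ with speed $1/\varepsilon_\mu$ and good rate function $$\tilde I_2(z)=\frac{z^2}{2x\Lambda''(0;\beta,1)},\qquad\text{where}\quad \Lambda''(0;\beta,1)=\frac{8\beta}{(\beta-1)^3}.$$ That is: $1/\varepsilon_\mu\to\infty$, $\tilde I_2$ is lower semicontinuous with compact level sets $\{\tilde I_2\le\eta\}$, $\eta\ge0$, and $$\limsup_{\mu\to\infty}\varepsilon_\mu\log P(Z_\mu\in F)\le-\inf_{z\in F}\tilde I_2(z)\quad\text{for all closed }F\subset\mathbb R,$$ $$\liminf_{\mu\to\infty}\varepsilon_\mu\log P(Z_\mu\in G)\ge-\inf_{z\in G}\tilde I_2(z)\quad\text{for all open }G\subset\mathbb R.$$ -/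

import Mathlib

open MeasureTheory ProbabilityTheory Filter Topology
open scoped ENNReal NNReal

noncomputable section

/-! ### Large deviation principles -/

/-- The family `(Z r)`, `r > 0`, of random variables on `(Ω, P)` with values in a topological space
satisfies, as `r → ∞`, the large deviation principle with speed `v` and rate function `I`.
Logarithms of probabilities are extended reals (`log 0 = -∞`), and an infimum over the empty set
is `+∞`. -/
structure SatisfiesLDP {Ω E : Type*} [MeasurableSpace Ω] [TopologicalSpace E]
    (P : Measure Ω) (Z : ℝ → Ω → E) (v : ℝ → ℝ) (I : E → ℝ≥0∞) : Prop where
  tendsto_speed : Tendsto v atTop atTop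
  lowerSemicontinuous : LowerSemicontinuous I
  upper_bound : ∀ F : Set E, IsClosed F →
    limsup (fun r : ℝ => ((1 / v r : ℝ) : EReal) * ENNReal.log (P {ω | Z r ω ∈ F})) atTop
      ≤ -(⨅ z ∈ F, (I z : EReal))
  lower_bound : ∀ G : Set E, IsOpen G →
    -(⨅ z ∈ G, (I z : EReal))
      ≤ liminf (fun r : ℝ => ((1 / v r : ℝ) : EReal) * ENNReal.log (P {ω | Z r ω ∈ G})) atTop

/-- A rate function is good if all its level sets are compact. -/
def IsGoodRateFunction {E : Type*} [TopologicalSpace E] (I : E → ℝ≥0∞) : Prop :=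
  ∀ η : ℝ≥0, IsCompact {z : E | I z ≤ η}

/-! ### The telegraph motion

A trajectory is driven by the durations `u 0, u 1, …` of its successive upward phases and the
durations `d 0, d 1, …` of its successive downward phases. It starts with an upward phase, and
the phases alternate: up for `u 0`, down for `d 0`, up for `u 1`, down for `d 1`, and so on. -/

/-- The starting time of the `n`-th upward phase. -/
def cycleStart (u d : ℕ → ℝ) (n : ℕ) : ℝ := ∑ k ∈ Finset.range n, (u k + d k)

open Classical in
/-- The velocity at time `t`: it is `+1` in the upward phases and `-1` in the downward ones. -/
def velocity (u d : ℕ → ℝ) (t : ℝ) : ℝ :=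
  if ∃ n, cycleStart u d n ≤ t ∧ t < cycleStart u d n + u n then 1 else -1

/-- The position at time `t` of the (free) telegraph motion that starts at `x`. -/
def position (x : ℝ) (u d : ℕ → ℝ) (t : ℝ) : ℝ := x + ∫ s in (0 : ℝ)..t, velocity u d s

/-- The time of the first arrival at the origin (for `x = 0`: of the first return to it) of the
motion that starts at `x` going upwards. -/
def firstArrival (x : ℝ) (u d : ℕ → ℝ) : ℝ := sInf {t : ℝ | 0 < t ∧ position x u d t = 0}

/-! ### The barrier at the origin and the absorption time -/

/-- The absorption time at the origin
`A_x = C_x + 1_{M > 1} ∑_{i = 1}^{M - 1} C_{0, i}` of a particle that starts at `x` going upwards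
and is absorbed at its `M`-th visit to the origin. Here `U 0`, `D 0` are the durations of the
phases until the first visit to the origin, and `U i`, `D i` for `i ≥ 1` are those of the phases
between the `i`-th visit, after which the particle goes upwards again, and the next one. -/
def absorptionTime {Ω : Type*} (x : ℝ) (M : Ω → ℕ) (U D : ℕ → ℕ → Ω → ℝ) (ω : Ω) : ℝ :=
  firstArrival x (fun k => U 0 k ω) (fun k => D 0 k ω) +
    ∑ i ∈ Finset.Icc 1 (M ω - 1), firstArrival 0 (fun k => U i k ω) (fun k => D i k ω)

/-- The number of visits is a positive integer valued random variable whose moment generating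
function is finite at some `s > 0`. -/
structure IsLightTailedCount {Ω : Type*} [MeasurableSpace Ω] (P : Measure Ω) (M : Ω → ℕ) :
    Prop where
  aemeasurable : AEMeasurable M P
  pos : ∀ᵐ ω ∂P, 1 ≤ M ω
  light_tail : ∃ s : ℝ, 0 < s ∧ Integrable (fun ω => Real.exp (s * M ω)) P

/-- The random mechanism with parameters `lam`, `mu`: upward phases are exponentially distributed
with rate `lam`, downward phases are exponentially distributed with rate `mu`, all the phases
are independent, and the number `M` of visits to the origin is independent of them. -/
structure IsTelegraphModel {Ω : Type*} [MeasurableSpace Ω] (P : Measure Ω) (lam mu : ℝ)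
    (M : Ω → ℕ) (U D : ℕ → ℕ → Ω → ℝ) : Prop where
  law_up : ∀ i k, HasLaw (U i k) (expMeasure lam) P
  law_down : ∀ i k, HasLaw (D i k) (expMeasure mu) P
  indep_phases : iIndepFun
    (Sum.elim (fun p : ℕ × ℕ => U p.1 p.2) (fun p : ℕ × ℕ => D p.1 p.2)) P
  indep_count : IndepFun M
    (fun ω (j : ℕ × ℕ ⊕ ℕ × ℕ) =>
      Sum.elim (fun p : ℕ × ℕ => U p.1 p.2) (fun p : ℕ × ℕ => D p.1 p.2) j ω) P

/-- The function `Λ(s; lam, mu)`. -/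
def telegraphLambda (s lam mu : ℝ) : ℝ :=
  (lam - mu - Real.sqrt ((lam + mu - 2 * s) ^ 2 - 4 * lam * mu)) / 2

/-- The second derivative `Λ''(0; lam, mu)` with respect to `s` at `s = 0`. -/
def telegraphLambdaSecond (lam mu : ℝ) : ℝ :=
  iteratedDeriv 2 (fun s => telegraphLambda s lam mu) 0

end

/-! Time plus position is constant along downward phases and grows at rate 2 along upward ones.
Hence the first arrival time from `x` is `x` plus twice the upward time up to the cycle in which the
origin is reached (`firstArrival_eq`), and it suffices to study the walk sampled at the starts of
the cycles.

Put `a = s - Λ(s)`. The function equal to `(μ - a)/μ * exp(-a w)` for `w > 0` and to 1 for `w ≤ 0`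
reproduces itself over one cycle weighted by `exp(2 s u)` (`lintegral_cycle_harmonic`); the
prefactor compensates the exponential overshoot below the origin. Iterating this equation, with a
geometrically small remainder, gives the transform of the arrival time, namely `φ(s) exp(x Λ(s))`
with `φ(s) = (μ - s + Λ(s))/μ`. Independence of the blocks and of `M` then gives `E exp(s A_x) =
exp(x Λ(s)) E[φ(s)^M]` (`lintegral_exp_absorptionTime`).

For `λ = βμ` scaling gives `Λ(μ s; βμ, μ) = μ Λ(s; β, 1)`, so `log E exp(μ s A_x) = x μ Λ(s; β, 1) +
log ψ(s)`, where `ψ` does not depend on `μ`, is differentiable at 0 and has `ψ(0) = 1`. Tilting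
`Z_μ` by `θ/ε` amounts to `s = δ = θ/√(με) → 0`. Centering cancels the linear term of `Λ`; its
quadratic term gives `x Λ''(0; β, 1) θ²/2` because `με δ² = θ²`; the visits contribute only `ε (log
ψ(δ) - δ ψ'(0)) → 0` (`tendsto_cgf_absorptionTime`). A quadratic limit of scaled cumulant generating
functions yields the large deviation principle (`satisfiesLDP_of_tendsto_cgf`): Chernoff bounds from
above, and from below a comparison of the moment generating function at the optimal tilt with its
values at two neighbouring tilts. -/

/-! ### First arrival of a telegraph path -/

/-- The position of the telegraph motion at the beginning of the `n`-th cycle. -/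
noncomputable def walk (x : ℝ) (u d : ℕ → ℝ) (n : ℕ) : ℝ :=
  x + ∑ k ∈ Finset.range n, (u k - d k)

lemma walk_zero (x : ℝ) (u d : ℕ → ℝ) : walk x u d 0 = x := by simp [walk]

lemma walk_succ (x : ℝ) (u d : ℕ → ℝ) (n : ℕ) :
    walk x u d (n + 1) = walk x u d n + u n - d n := by
  simp only [walk, Finset.sum_range_succ]; ring

lemma cycleStart_zero (u d : ℕ → ℝ) : cycleStart u d 0 = 0 := by simp [cycleStart]

lemma cycleStart_succ (u d : ℕ → ℝ) (n : ℕ) :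
    cycleStart u d (n + 1) = cycleStart u d n + u n + d n := by
  simp only [cycleStart, Finset.sum_range_succ]; ring

/-- Downward durations cancel in time plus position. At an arrival the position is zero and this
quantity is the elapsed time, so only upward durations enter `firstArrival_eq`. -/
lemma cycleStart_add_walk (x : ℝ) (u d : ℕ → ℝ) (n : ℕ) :
    cycleStart u d n + walk x u d n = x + 2 * ∑ k ∈ Finset.range n, u k := by
  induction n with
  | zero => simp [cycleStart_zero, walk_zero]
  | succ n ih => rw [cycleStart_succ, walk_succ, Finset.sum_range_succ]; linarith

/-- Integrability travels with the value because adjacent integrals can be added only when both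
pieces are integrable. -/
lemma intervalIntegrable_and_integral_of_eqOn_Ico {f : ℝ → ℝ} {a b c : ℝ} (hab : a ≤ b)
    (hf : ∀ t ∈ Set.Ico a b, f t = c) :
    IntervalIntegrable f volume a b ∧ ∫ t in a..b, f t = c * (b - a) := by
  have h : Set.EqOn (fun _ : ℝ => c) f (Set.uIoo a b) := fun t ht => by
    rw [Set.uIoo_of_le hab] at ht
    exact (hf t ⟨ht.1.le, ht.2⟩).symm
  refine ⟨(intervalIntegrable_congr_uIoo h).1 intervalIntegrable_const, ?_⟩
  rw [← intervalIntegral.integral_congr_uIoo h]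
  simp [mul_comm]

section Path

variable {x : ℝ} {u d : ℕ → ℝ}

lemma cycleStart_strictMono (hu : ∀ k, 0 < u k) (hd : ∀ k, 0 < d k) :
    StrictMono (cycleStart u d) :=
  strictMono_nat_of_lt_succ fun n => by
    rw [cycleStart_succ]; linarith [hu n, hd n]

lemma velocity_up {n : ℕ} {t : ℝ} (h₁ : cycleStart u d n ≤ t) (h₂ : t < cycleStart u d n + u n) :
    velocity u d t = 1 := if_pos ⟨n, h₁, h₂⟩

lemma velocity_down (hu : ∀ k, 0 < u k) (hd : ∀ k, 0 < d k) {n : ℕ} {t : ℝ}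
    (h₁ : cycleStart u d n + u n ≤ t) (h₂ : t < cycleStart u d n + u n + d n) :
    velocity u d t = -1 := by
  refine if_neg ?_
  rintro ⟨m, hm₁, hm₂⟩
  have hmono := (cycleStart_strictMono hu hd).monotone
  rcases lt_trichotomy m n with h | rfl | h
  · have := hmono (Nat.succ_le_of_lt h)
    rw [Nat.succ_eq_add_one, cycleStart_succ] at this
    linarith [hd m, hu n]
  · linarith
  · have := hmono (Nat.succ_le_of_lt h)
    rw [Nat.succ_eq_add_one, cycleStart_succ] at this
    linarith

lemma intervalIntegrable_velocity_and_position_cycleStart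
    (hu : ∀ k, 0 < u k) (hd : ∀ k, 0 < d k) (x : ℝ) (n : ℕ) :
    IntervalIntegrable (velocity u d) volume 0 (cycleStart u d n) ∧
      position x u d (cycleStart u d n) = walk x u d n := by
  induction n with
  | zero => simp [cycleStart_zero, walk_zero, position]
  | succ n ih =>
    have hup := intervalIntegrable_and_integral_of_eqOn_Ico
      (f := velocity u d) (a := cycleStart u d n) (b := cycleStart u d n + u n) (c := 1)
      (by linarith [hu n]) fun t ht => velocity_up ht.1 ht.2
    have hdown := intervalIntegrable_and_integral_of_eqOn_Ico
      (f := velocity u d) (a := cycleStart u d n + u n) (b := cycleStart u d n + u n + d n)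
      (c := -1) (by linarith [hd n]) fun t ht => velocity_down hu hd ht.1 ht.2
    rw [cycleStart_succ]
    refine ⟨(ih.1.trans hup.1).trans hdown.1, ?_⟩
    have h := ih.2
    unfold position at h ⊢
    rw [← intervalIntegral.integral_add_adjacent_intervals (ih.1.trans hup.1) hdown.1,
      ← intervalIntegral.integral_add_adjacent_intervals ih.1 hup.1, hup.2, hdown.2, walk_succ]
    linarith

lemma position_up (hu : ∀ k, 0 < u k) (hd : ∀ k, 0 < d k) {n : ℕ} {t : ℝ}
    (h₁ : cycleStart u d n ≤ t) (h₂ : t ≤ cycleStart u d n + u n) :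
    position x u d t = walk x u d n + (t - cycleStart u d n) := by
  obtain ⟨hi, h⟩ := intervalIntegrable_velocity_and_position_cycleStart hu hd x n
  have hup := intervalIntegrable_and_integral_of_eqOn_Ico (f := velocity u d) (c := 1) h₁
    fun s hs => velocity_up hs.1 (hs.2.trans_le h₂)
  unfold position at h ⊢
  rw [← intervalIntegral.integral_add_adjacent_intervals hi hup.1, hup.2]
  linarith

lemma position_down (hu : ∀ k, 0 < u k) (hd : ∀ k, 0 < d k) {n : ℕ} {t : ℝ}
    (h₁ : cycleStart u d n + u n ≤ t) (h₂ : t ≤ cycleStart u d n + u n + d n) :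
    position x u d t = walk x u d n + u n - (t - cycleStart u d n - u n) := by
  obtain ⟨hi, h⟩ := intervalIntegrable_velocity_and_position_cycleStart hu hd x n
  have hup := intervalIntegrable_and_integral_of_eqOn_Ico
    (f := velocity u d) (a := cycleStart u d n) (b := cycleStart u d n + u n) (c := 1)
    (by linarith [hu n]) fun t ht => velocity_up ht.1 ht.2
  have hdown := intervalIntegrable_and_integral_of_eqOn_Ico (f := velocity u d) (c := -1) h₁
    fun s hs => velocity_down hu hd hs.1 (hs.2.trans_le h₂)
  unfold position at h ⊢
  rw [← intervalIntegral.integral_add_adjacent_intervals (hi.trans hup.1) hdown.1,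
    ← intervalIntegral.integral_add_adjacent_intervals hi hup.1, hup.2, hdown.2]
  linarith

/-- If the walk becomes nonpositive for the first time at the end of the `N`-th cycle, the motion
arrives at the origin during the `N`-th downward phase, and the time of arrival is determined by
the total duration of the upward phases. -/
lemma firstArrival_eq (hx : 0 ≤ x) (hu : ∀ k, 0 < u k) (hd : ∀ k, 0 < d k) {N : ℕ}
    (hpos : ∀ k < N, 0 < walk x u d (k + 1)) (hN : walk x u d (N + 1) ≤ 0) :
    firstArrival x u d = x + 2 * ∑ k ∈ Finset.range (N + 1), u k := by
  have hmono := cycleStart_strictMono hu hd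
  have hwalk : ∀ k ≤ N, 0 ≤ walk x u d k := by
    rintro (_ | k) hk
    · rwa [walk_zero]
    · exact (hpos k hk).le
  -- The claimed arrival time is the end of the `N`-th upward phase plus the height reached there,
  -- which is then descended at unit speed.
  have hstar : x + 2 * ∑ k ∈ Finset.range (N + 1), u k
      = cycleStart u d N + u N + (walk x u d N + u N) := by
    rw [Finset.sum_range_succ]; linarith [cycleStart_add_walk x u d N]
  have hT : 0 ≤ cycleStart u d N := by
    simpa [cycleStart_zero] using hmono.monotone (Nat.zero_le N)
  have hN' : walk x u d N + u N ≤ d N := by rw [walk_succ] at hN; linarith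
  have hWN := hwalk N le_rfl
  rw [hstar]
  refine IsLeast.csInf_eq ⟨⟨by linarith [hu N], ?_⟩, ?_⟩
  · rw [position_down hu hd (by linarith [hu N]) (by linarith)]; ring
  rintro t ⟨ht0, ht⟩
  by_contra! hlt
  have hex : ∃ n, t < cycleStart u d (n + 1) := ⟨N, by rw [cycleStart_succ]; linarith⟩
  classical
  obtain ⟨n, hn, hmin⟩ : ∃ n, t < cycleStart u d (n + 1) ∧ ∀ m < n, cycleStart u d (m + 1) ≤ t :=
    ⟨Nat.find hex, Nat.find_spec hex, fun m hm => not_lt.1 (Nat.find_min hex hm)⟩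
  have hnN : n ≤ N := by
    by_contra! h
    have := hmin N h
    rw [cycleStart_succ] at this
    linarith
  have hle : cycleStart u d n ≤ t := by
    rcases n with _ | n
    · rw [cycleStart_zero]; exact ht0.le
    · exact hmin n (Nat.lt_succ_self n)
  rw [cycleStart_succ] at hn
  have hWn := hwalk n hnN
  rcases le_total t (cycleStart u d n + u n) with h | h
  -- An upward phase starts at a positive height, except possibly the first one when `x = 0`; there
  -- `0 < t` excludes the starting point.
  · rw [position_up hu hd hle h] at ht
    rcases n with _ | n
    · rw [cycleStart_zero] at ht; linarith
    · linarith [hpos n hnN]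
  -- In an earlier cycle the position stays above the positive value at the end of the cycle; in the
  -- `N`-th one it is positive before the claimed time.
  · rw [position_down hu hd h hn.le] at ht
    rcases hnN.lt_or_eq with hnN | rfl
    · have := hpos n hnN
      rw [walk_succ] at this
      linarith
    · linarith

end Path

/-! ### Exponential integrals -/

lemma ae_pos_expMeasure (r : ℝ) : ∀ᵐ t ∂expMeasure r, 0 < t := by
  have h : expMeasure r = volume.withDensity (exponentialPDF r) := rfl
  have hm : Measurable (exponentialPDF r) := (measurable_exponentialPDFReal r).ennreal_ofReal
  rw [h, ae_withDensity_iff hm]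
  have h0 : ∀ᵐ t : ℝ, t ≠ 0 := by simp [ae_iff]
  filter_upwards [h0] with t ht0 ht
  by_contra! hle
  exact ht (exponentialPDF_of_neg (lt_of_le_of_ne hle ht0))

lemma setLIntegral_exp_expMeasure {r t y : ℝ} (hr : 0 < r) (ht : t < r) (hy : 0 ≤ y) :
    ∫⁻ v in Set.Ici y, ENNReal.ofReal (Real.exp (t * v)) ∂expMeasure r
      = ENNReal.ofReal (r / (r - t) * Real.exp (-(r - t) * y)) := by
  have h : expMeasure r = volume.withDensity (exponentialPDF r) := rfl
  have hm : Measurable (exponentialPDF r) := (measurable_exponentialPDFReal r).ennreal_ofReal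
  rw [h, restrict_withDensity measurableSet_Ici,
    lintegral_withDensity_eq_lintegral_mul _ hm (by fun_prop)]
  have hcongr : ∫⁻ v in Set.Ici y, (exponentialPDF r * fun v => ENNReal.ofReal (Real.exp (t * v))) v
      = ∫⁻ v in Set.Ici y, ENNReal.ofReal (r * Real.exp (-(r - t) * v)) := by
    refine setLIntegral_congr_fun measurableSet_Ici fun v hv => ?_
    simp only [Pi.mul_apply]
    rw [exponentialPDF_of_nonneg (hy.trans hv), ← ENNReal.ofReal_mul (by positivity), mul_assoc,
      ← Real.exp_add]
    ring_nf
  have hneg : -(r - t) < 0 := by linarith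
  have hint : IntegrableOn (fun v => r * Real.exp (-(r - t) * v)) (Set.Ioi y) :=
    (integrableOn_exp_mul_Ioi hneg y).const_mul r
  rw [hcongr, setLIntegral_congr Ioi_ae_eq_Ici.symm, ← ofReal_integral_eq_lintegral_ofReal hint
    (Eventually.of_forall fun v => by positivity), integral_const_mul, integral_exp_mul_Ioi hneg]
  congr 1
  have : r - t ≠ 0 := by linarith
  field_simp

lemma lintegral_exp_expMeasure {r t : ℝ} (hr : 0 < r) (ht : t < r) :
    ∫⁻ v, ENNReal.ofReal (Real.exp (t * v)) ∂expMeasure r = ENNReal.ofReal (r / (r - t)) := by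
  have h := setLIntegral_exp_expMeasure hr ht le_rfl
  rw [mul_zero, Real.exp_zero, mul_one] at h
  rw [← h, Measure.restrict_eq_self_of_ae_mem]
  exact (ae_pos_expMeasure r).mono fun v hv => hv.le

/-- Without killing at the origin, `exp (-c w)` is an eigenfunction of the weighted one-cycle
kernel. For a suitable `c` the eigenvalue is below one, which makes the remainder of the iteration
geometrically small. -/
lemma lintegral_cycle {lam mu s c w : ℝ} (hlam : 0 < lam) (hmu : 0 < mu) (hc : c < mu)
    (hc' : 2 * s - c < lam) :
    ∫⁻ u, ∫⁻ d, ENNReal.ofReal (Real.exp (2 * s * u)) *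
        ENNReal.ofReal (Real.exp (-c * (w + u - d))) ∂expMeasure mu ∂expMeasure lam
      = ENNReal.ofReal (lam * mu / ((lam - 2 * s + c) * (mu - c)) * Real.exp (-c * w)) := by
  have h : ∀ u, ∫⁻ d, ENNReal.ofReal (Real.exp (2 * s * u)) *
      ENNReal.ofReal (Real.exp (-c * (w + u - d))) ∂expMeasure mu
      = ENNReal.ofReal (mu / (mu - c) * Real.exp (-c * w)) *
          ENNReal.ofReal (Real.exp ((2 * s - c) * u)) := fun u => by
    have : ∀ d, ENNReal.ofReal (Real.exp (2 * s * u)) *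
        ENNReal.ofReal (Real.exp (-c * (w + u - d)))
        = ENNReal.ofReal (Real.exp (-c * w) * Real.exp ((2 * s - c) * u)) *
          ENNReal.ofReal (Real.exp (c * d)) := fun d => by
      rw [← ENNReal.ofReal_mul (by positivity), ← ENNReal.ofReal_mul (by positivity),
        ← Real.exp_add, ← Real.exp_add, ← Real.exp_add]
      ring_nf
    simp_rw [this]
    rw [lintegral_const_mul _ (by fun_prop), lintegral_exp_expMeasure hmu hc,
      ← ENNReal.ofReal_mul (by positivity), ← ENNReal.ofReal_mul
        (mul_nonneg (div_nonneg hmu.le (by linarith)) (by positivity))]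
    congr 1
    ring
  simp_rw [h]
  have h1 : 0 < mu - c := by linarith
  have h2 : 0 < lam - 2 * s + c := by linarith
  rw [lintegral_const_mul _ (by fun_prop), lintegral_exp_expMeasure hlam hc',
    ← ENNReal.ofReal_mul (by positivity)]
  congr 1
  rw [show lam - (2 * s - c) = lam - 2 * s + c by ring]
  field_simp

/-- By lack of memory the overshoot `d - y` on `d ≥ y` is again exponential with rate `mu`, so `exp
(a (d - y))` averages to `mu / (mu - a)` there. The factor `(mu - a) / mu` turns this into one, and
the boundary value 1 can be replaced by the exponential without changing the integral. -/
lemma lintegral_descent {mu a y : ℝ} (hmu : 0 < mu) (ha : a < mu) (hy : 0 ≤ y) :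
    ∫⁻ d, (if y - d ≤ 0 then 1 else ENNReal.ofReal ((mu - a) / mu * Real.exp (-a * (y - d))))
      ∂expMeasure mu = ENNReal.ofReal (Real.exp (-a * y)) := by
  have h1 : 0 < mu - a := by linarith
  have hF : ∀ d, ENNReal.ofReal ((mu - a) / mu * Real.exp (-a * (y - d)))
      = ENNReal.ofReal ((mu - a) / mu * Real.exp (-a * y)) * ENNReal.ofReal (Real.exp (a * d)) :=
    fun d => by
      rw [← ENNReal.ofReal_mul (by positivity), mul_assoc, ← Real.exp_add]
      ring_nf
  have htail : ∫⁻ d in Set.Ici y, ENNReal.ofReal ((mu - a) / mu * Real.exp (-a * (y - d)))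
      ∂expMeasure mu = ∫⁻ _ in Set.Ici y, 1 ∂expMeasure mu := by
    have := setLIntegral_exp_expMeasure hmu hmu hy
    simp only [zero_mul, Real.exp_zero, ENNReal.ofReal_one] at this
    rw [this]
    simp_rw [hF]
    rw [lintegral_const_mul _ (by fun_prop), setLIntegral_exp_expMeasure hmu ha hy,
      ← ENNReal.ofReal_mul (by positivity)]
    congr 1
    rw [sub_zero, div_self hmu.ne', one_mul,
      show -mu * y = -a * y + -(mu - a) * y by ring, Real.exp_add]
    field_simp
  have htot : ∫⁻ d, ENNReal.ofReal ((mu - a) / mu * Real.exp (-a * (y - d))) ∂expMeasure mu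
      = ENNReal.ofReal (Real.exp (-a * y)) := by
    simp_rw [hF]
    rw [lintegral_const_mul _ (by fun_prop), lintegral_exp_expMeasure hmu ha,
      ← ENNReal.ofReal_mul (by positivity)]
    congr 1
    field_simp
  rw [← htot, ← lintegral_add_compl _ (measurableSet_Ici (a := y)),
    ← lintegral_add_compl (fun d => ENNReal.ofReal ((mu - a) / mu * Real.exp (-a * (y - d))))
      (measurableSet_Ici (a := y)), htail]
  congr 1
  · exact setLIntegral_congr_fun measurableSet_Ici fun d hd => if_pos (sub_nonpos.2 hd)
  · refine setLIntegral_congr_fun measurableSet_Ici.compl fun d hd => if_neg ?_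
    rw [Set.mem_compl_iff, Set.mem_Ici] at hd
    linarith

/-- The one-cycle equation solved by the Laplace transform of the first arrival time. -/
lemma lintegral_cycle_harmonic {lam mu s a w : ℝ} (hlam : 0 < lam) (hmu : 0 < mu) (ha : a < mu)
    (ha' : 2 * s - a < lam) (hroot : (lam - 2 * s + a) * (mu - a) = lam * mu) (hw : 0 ≤ w) :
    ∫⁻ u, ∫⁻ d, ENNReal.ofReal (Real.exp (2 * s * u)) *
        (if w + u - d ≤ 0 then 1
          else ENNReal.ofReal ((mu - a) / mu * Real.exp (-a * (w + u - d))))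
        ∂expMeasure mu ∂expMeasure lam
      = ENNReal.ofReal ((mu - a) / mu * Real.exp (-a * w)) := by
  have h : ∀ᵐ u ∂expMeasure lam, ∫⁻ d, ENNReal.ofReal (Real.exp (2 * s * u)) *
        (if w + u - d ≤ 0 then 1
          else ENNReal.ofReal ((mu - a) / mu * Real.exp (-a * (w + u - d)))) ∂expMeasure mu
      = ENNReal.ofReal (Real.exp (-a * w)) * ENNReal.ofReal (Real.exp ((2 * s - a) * u)) := by
    filter_upwards [ae_pos_expMeasure lam] with u hu
    rw [lintegral_const_mul' _ _ ENNReal.ofReal_ne_top, lintegral_descent hmu ha (by linarith),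
      ← ENNReal.ofReal_mul (by positivity), ← ENNReal.ofReal_mul (by positivity), ← Real.exp_add,
      ← Real.exp_add]
    ring_nf
  have h2 : 0 < lam - 2 * s + a := by linarith
  rw [lintegral_congr_ae h, lintegral_const_mul _ (by fun_prop), lintegral_exp_expMeasure hlam ha',
    ← ENNReal.ofReal_mul (by positivity)]
  congr 1
  rw [show lam - (2 * s - a) = lam - 2 * s + a by ring]
  field_simp
  linarith

/-! ### The law of the phases between two visits to the origin -/

/-- As `f` ignores the coordinates outside `S`, filling them with `default` makes it a measurable
function of the finite subfamily indexed by `S`. -/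
lemma ProbabilityTheory.iIndepFun.indepFun_of_dependsOn_finset {Ω ι E : Type*} {X : ι → Type*}
    [MeasurableSpace Ω] [MeasurableSpace E] [∀ i, MeasurableSpace (X i)] [∀ i, Inhabited (X i)]
    {P : Measure Ω} {V : ∀ i, Ω → X i} (hV : iIndepFun V P) (hVm : ∀ i, Measurable (V i))
    {S T : Finset ι} (hST : Disjoint S T) {f : (∀ i, X i) → E} (hf : Measurable f)
    (hfS : ∀ b b' : ∀ i, X i, (∀ i ∈ S, b i = b' i) → f b = f b') :
    IndepFun (fun ω => f fun i => V i ω) (fun ω (i : T) => V i ω) P := by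
  classical
  have h := hV.indepFun_finset S T hST hVm
  have hg : Measurable fun y : ∀ i : S, X i => f fun i => if h : i ∈ S then y ⟨i, h⟩ else default := by
    refine hf.comp (measurable_pi_lambda _ fun i => ?_)
    split_ifs <;> fun_prop
  have hcomp := h.comp hg measurable_id
  have heq : (fun ω => f fun i => V i ω) = (fun y : ∀ i : S, X i =>
      f fun i => if h : i ∈ S then y ⟨i, h⟩ else default) ∘ fun ω (i : S) => V i ω := by
    ext ω
    exact hfS _ _ fun i hi => by simp [hi]
  rw [heq]
  exact hcomp

/-- The laws of the durations of the upward phases (left) and of the downward phases (right). -/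
noncomputable def phaseLaw (lam mu : ℝ) : ℕ ⊕ ℕ → Measure ℝ :=
  Sum.elim (fun _ => expMeasure lam) fun _ => expMeasure mu

/-- The joint law of the independent phases between two visits to the origin. -/
noncomputable def blockLaw (lam mu : ℝ) : Measure (ℕ ⊕ ℕ → ℝ) :=
  Measure.infinitePi (phaseLaw lam mu)

lemma isProbabilityMeasure_phaseLaw {lam mu : ℝ} (hlam : 0 < lam) (hmu : 0 < mu) (j : ℕ ⊕ ℕ) :
    IsProbabilityMeasure (phaseLaw lam mu j) := by
  rcases j with j | j
  · exact isProbabilityMeasure_expMeasure hlam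
  · exact isProbabilityMeasure_expMeasure hmu

/-- The position at the beginning of the `n`-th cycle, as a function of the sequence of phases. -/
noncomputable def blockWalk (x : ℝ) (b : ℕ ⊕ ℕ → ℝ) (n : ℕ) : ℝ :=
  walk x (fun k => b (Sum.inl k)) (fun k => b (Sum.inr k)) n

/-- The first arrival time, as a function of the sequence of phases. -/
noncomputable def blockArrival (x : ℝ) (b : ℕ ⊕ ℕ → ℝ) : ℝ :=
  firstArrival x (fun k => b (Sum.inl k)) (fun k => b (Sum.inr k))

/-- The sequences of phases for which the origin is reached during the `n`-th cycle. -/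
def arrivalCycle (x : ℝ) (n : ℕ) : Set (ℕ ⊕ ℕ → ℝ) :=
  {b | (∀ k < n, 0 < blockWalk x b (k + 1)) ∧ blockWalk x b (n + 1) ≤ 0}

open Classical in
/-- The weight of the sequences of phases for which the origin is not reached during the first
`n` cycles, exponential in the total duration of the upward phases. -/
noncomputable def survivalWeight (x s : ℝ) (n : ℕ) (b : ℕ ⊕ ℕ → ℝ) : ℝ≥0∞ :=
  if ∀ k < n, 0 < blockWalk x b (k + 1) then
    ENNReal.ofReal (Real.exp (2 * s * ∑ k ∈ Finset.range n, b (Sum.inl k))) else 0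

@[fun_prop]
lemma measurable_blockWalk (x : ℝ) (n : ℕ) : Measurable fun b => blockWalk x b n := by
  unfold blockWalk walk; fun_prop

lemma blockWalk_succ (x : ℝ) (b : ℕ ⊕ ℕ → ℝ) (n : ℕ) :
    blockWalk x b (n + 1) = blockWalk x b n + b (Sum.inl n) - b (Sum.inr n) := walk_succ _ _ _ _

lemma measurableSet_survival (x : ℝ) (n : ℕ) :
    MeasurableSet {b : ℕ ⊕ ℕ → ℝ | ∀ k < n, 0 < blockWalk x b (k + 1)} := by
  simp only [Set.ofPred_forall]
  exact MeasurableSet.iInter fun k => MeasurableSet.iInter fun _ =>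
    measurableSet_lt measurable_const (measurable_blockWalk x _)

lemma measurableSet_arrivalCycle (x : ℝ) (n : ℕ) : MeasurableSet (arrivalCycle x n) :=
  (measurableSet_survival x n).inter
    (measurableSet_le (measurable_blockWalk x _) measurable_const)

lemma pairwise_disjoint_arrivalCycle (x : ℝ) :
    Pairwise (Function.onFun Disjoint (arrivalCycle x)) := by
  intro m n hmn
  wlog h : m < n generalizing m n
  · exact (this hmn.symm (lt_of_le_of_ne (not_lt.1 h) hmn.symm)).symm
  exact Set.disjoint_left.2 fun b hm hn => (hn.1 m h).not_ge hm.2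

@[fun_prop]
lemma measurable_survivalWeight (x s : ℝ) (n : ℕ) : Measurable (survivalWeight x s n) := by
  unfold survivalWeight
  exact Measurable.ite (measurableSet_survival x n) (by fun_prop) measurable_const

/-- A path that has survived `n` cycles either arrives in the next one or survives it; integrating
this pathwise identity gives the recursion for the transform. -/
lemma survivalWeight_mul_exp (x s : ℝ) (n : ℕ) (b : ℕ ⊕ ℕ → ℝ) (g : ℝ → ℝ≥0∞) :
    survivalWeight x s n b * (ENNReal.ofReal (Real.exp (2 * s * b (Sum.inl n))) *
        (if blockWalk x b (n + 1) ≤ 0 then 1 else g (blockWalk x b (n + 1))))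
      = (arrivalCycle x n).indicator (fun b => ENNReal.ofReal
          (Real.exp (2 * s * ∑ k ∈ Finset.range (n + 1), b (Sum.inl k)))) b
        + survivalWeight x s (n + 1) b * g (blockWalk x b (n + 1)) := by
  classical
  have hexp : ENNReal.ofReal (Real.exp (2 * s * ∑ k ∈ Finset.range n, b (Sum.inl k))) *
      ENNReal.ofReal (Real.exp (2 * s * b (Sum.inl n)))
      = ENNReal.ofReal (Real.exp (2 * s * ∑ k ∈ Finset.range (n + 1), b (Sum.inl k))) := by
    rw [← ENNReal.ofReal_mul (by positivity), ← Real.exp_add, Finset.sum_range_succ, mul_add]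
  unfold survivalWeight arrivalCycle
  simp only [Set.indicator_apply, Set.mem_ofPred_eq, Nat.forall_lt_succ_right]
  by_cases h1 : ∀ k < n, 0 < blockWalk x b (k + 1)
  · by_cases h2 : blockWalk x b (n + 1) ≤ 0
    · rw [if_pos h1, if_pos h2, if_pos ⟨h1, h2⟩, if_neg fun h => not_lt.2 h2 h.2, mul_one, hexp,
        zero_mul, add_zero]
    · rw [if_pos h1, if_neg h2, if_neg fun h => h2 h.2, if_pos ⟨h1, not_le.1 h2⟩, ← mul_assoc,
        hexp, zero_add]
  · rw [if_neg h1, zero_mul, if_neg fun h => h1 h.1, if_neg fun h => h1 h.1, zero_mul, zero_add]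

lemma blockWalk_congr {x : ℝ} {n m : ℕ} (hm : m ≤ n) {b b' : ℕ ⊕ ℕ → ℝ}
    (h : ∀ j ∈ (Finset.range n).disjSum (Finset.range n), b j = b' j) :
    blockWalk x b m = blockWalk x b' m := by
  unfold blockWalk walk
  congr 1
  refine Finset.sum_congr rfl fun k hk => ?_
  have hk' : k < n := (Finset.mem_range.1 hk).trans_le hm
  beta_reduce
  rw [h (Sum.inl k) (by simpa using hk'), h (Sum.inr k) (by simpa using hk')]

lemma survivalWeight_congr {x s : ℝ} {n : ℕ} {b b' : ℕ ⊕ ℕ → ℝ}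
    (h : ∀ j ∈ (Finset.range n).disjSum (Finset.range n), b j = b' j) :
    survivalWeight x s n b = survivalWeight x s n b' := by
  have h1 : (∀ k < n, 0 < blockWalk x b (k + 1)) ↔ ∀ k < n, 0 < blockWalk x b' (k + 1) :=
    forall₂_congr fun k hk => by rw [blockWalk_congr hk h]
  have h2 : ∑ k ∈ Finset.range n, b (Sum.inl k) = ∑ k ∈ Finset.range n, b' (Sum.inl k) :=
    Finset.sum_congr rfl fun k hk => h _ (by simpa using hk)
  simp only [survivalWeight, h1, h2]

lemma isProbabilityMeasure_blockLaw {lam mu : ℝ} (hlam : 0 < lam) (hmu : 0 < mu) :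
    IsProbabilityMeasure (blockLaw lam mu) := by
  have := isProbabilityMeasure_phaseLaw hlam hmu
  unfold blockLaw; infer_instance

lemma ae_pos_blockLaw {lam mu : ℝ} (hlam : 0 < lam) (hmu : 0 < mu) :
    ∀ᵐ b ∂blockLaw lam mu, ∀ j, 0 < b j := by
  have := isProbabilityMeasure_phaseLaw hlam hmu
  refine ae_all_iff.2 fun j => ?_
  have h := (measurePreserving_eval_infinitePi (phaseLaw lam mu) j).quasiMeasurePreserving.ae
    (p := fun t => 0 < t) (by rcases j with j | j <;> exact ae_pos_expMeasure _)
  exact h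

/-- The phases of the `n`-th cycle are independent of what happened before. -/
lemma lintegral_blockLaw_cycle {lam mu : ℝ} (hlam : 0 < lam) (hmu : 0 < mu) {E : Type*}
    [MeasurableSpace E] (n : ℕ) {f : (ℕ ⊕ ℕ → ℝ) → E}
    (hf : Measurable f)
    (hfn : ∀ b b' : ℕ ⊕ ℕ → ℝ, (∀ j ∈ (Finset.range n).disjSum (Finset.range n), b j = b' j) →
      f b = f b') {h : E → ℝ → ℝ → ℝ≥0∞}
    (hh : Measurable fun p : E × (ℝ × ℝ) => h p.1 p.2.1 p.2.2) :
    ∫⁻ b, h (f b) (b (Sum.inl n)) (b (Sum.inr n)) ∂blockLaw lam mu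
      = ∫⁻ b, ∫⁻ u, ∫⁻ d, h (f b) u d ∂expMeasure mu ∂expMeasure lam ∂blockLaw lam mu := by
  have := isProbabilityMeasure_phaseLaw hlam hmu
  have hP := isProbabilityMeasure_blockLaw hlam hmu
  have := isProbabilityMeasure_expMeasure hlam
  have := isProbabilityMeasure_expMeasure hmu
  let T : Finset (ℕ ⊕ ℕ) := {Sum.inl n, Sum.inr n}
  have hindep : iIndepFun (fun (j : ℕ ⊕ ℕ) (b : ℕ ⊕ ℕ → ℝ) => b j) (blockLaw lam mu) :=
    iIndepFun_infinitePi (X := fun _ t => t) fun _ => measurable_id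
  have hdisj : Disjoint ((Finset.range n).disjSum (Finset.range n)) T := by
    simp only [T, Finset.disjoint_left]
    rintro (k | k) hk <;> simp at hk ⊢ <;> exact hk.ne
  have hI := hindep.indepFun_of_dependsOn_finset (fun j => measurable_pi_apply j) hdisj hf hfn
  have hJ : IndepFun f (fun b : ℕ ⊕ ℕ → ℝ => (b (Sum.inl n), b (Sum.inr n))) (blockLaw lam mu) := by
    have hg : Measurable fun y : T → ℝ =>
        (y ⟨Sum.inl n, by simp [T]⟩, y ⟨Sum.inr n, by simp [T]⟩) := by fun_prop
    exact hI.comp measurable_id hg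
  have hmap := hJ.map_prod_eq_prod_map_map hf.aemeasurable (by fun_prop)
  have hlaw : (blockLaw lam mu).map (fun b : ℕ ⊕ ℕ → ℝ => (b (Sum.inl n), b (Sum.inr n)))
      = (expMeasure lam).prod (expMeasure mu) :=
    Measure.infinitePi_map_eval_prod (P := phaseLaw lam mu) (by simp)
  have hm : Measurable fun b : ℕ ⊕ ℕ → ℝ => (f b, (b (Sum.inl n), b (Sum.inr n))) := by fun_prop
  have hm' : Measurable fun e => ∫⁻ q : ℝ × ℝ, h e q.1 q.2 ∂(expMeasure lam).prod (expMeasure mu) :=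
    hh.lintegral_prod_right'
  have hfin : IsProbabilityMeasure ((blockLaw lam mu).map f) :=
    Measure.isProbabilityMeasure_map hf.aemeasurable
  calc ∫⁻ b, h (f b) (b (Sum.inl n)) (b (Sum.inr n)) ∂blockLaw lam mu
      = ∫⁻ p, h p.1 p.2.1 p.2.2 ∂((blockLaw lam mu).map
          fun b : ℕ ⊕ ℕ → ℝ => (f b, (b (Sum.inl n), b (Sum.inr n)))) :=
        (lintegral_map hh hm).symm
    _ = ∫⁻ b, ∫⁻ q : ℝ × ℝ, h (f b) q.1 q.2 ∂(expMeasure lam).prod (expMeasure mu)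
          ∂blockLaw lam mu := by
        rw [hmap, hlaw, lintegral_prod _ hh.aemeasurable, lintegral_map hm' hf]
    _ = _ := by
        refine lintegral_congr fun b => ?_
        exact lintegral_prod (fun q : ℝ × ℝ => h (f b) q.1 q.2)
          (hh.comp (measurable_const.prodMk measurable_id)).aemeasurable

/-! ### The moment generating function of the first arrival time -/

lemma blockWalk_zero (x : ℝ) (b : ℕ ⊕ ℕ → ℝ) : blockWalk x b 0 = x := walk_zero _ _ _

lemma survivalWeight_zero (x s : ℝ) (b : ℕ ⊕ ℕ → ℝ) : survivalWeight x s 0 b = 1 := by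
  simp [survivalWeight]

lemma survivalWeight_eq_zero_or_nonneg {x s : ℝ} (hx : 0 ≤ x) (n : ℕ) (b : ℕ ⊕ ℕ → ℝ) :
    survivalWeight x s n b = 0 ∨ 0 ≤ blockWalk x b n := by
  by_cases h : ∀ k < n, 0 < blockWalk x b (k + 1)
  · right
    rcases n with _ | n
    · rwa [blockWalk_zero]
    · exact (h n (Nat.lt_succ_self n)).le
  · exact Or.inl (if_neg h)

lemma survivalWeight_succ_le (x s : ℝ) (n : ℕ) (b : ℕ ⊕ ℕ → ℝ) :
    survivalWeight x s (n + 1) b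
      ≤ survivalWeight x s n b * ENNReal.ofReal (Real.exp (2 * s * b (Sum.inl n))) := by
  unfold survivalWeight
  split_ifs with h1 h2 h2
  · rw [← ENNReal.ofReal_mul (by positivity), ← Real.exp_add, Finset.sum_range_succ, mul_add]
  · exact absurd (fun k hk => h1 k (hk.trans (Nat.lt_succ_self n))) h2
  · exact zero_le
  · exact zero_le

/-- The one-cycle equation is integrated over the surviving paths, from which the fresh cycle is
independent; the boundary value 1 collects the paths that arrive now. -/
lemma lintegral_survivalWeight_succ {lam mu s a x : ℝ} (hlam : 0 < lam) (hmu : 0 < mu)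
    (ha : a < mu) (ha' : 2 * s - a < lam) (hroot : (lam - 2 * s + a) * (mu - a) = lam * mu)
    (hx : 0 ≤ x) (n : ℕ) :
    ∫⁻ b, survivalWeight x s n b *
        ENNReal.ofReal ((mu - a) / mu * Real.exp (-a * blockWalk x b n)) ∂blockLaw lam mu
      = ∫⁻ b in arrivalCycle x n, ENNReal.ofReal
          (Real.exp (2 * s * ∑ k ∈ Finset.range (n + 1), b (Sum.inl k))) ∂blockLaw lam mu
        + ∫⁻ b, survivalWeight x s (n + 1) b *
          ENNReal.ofReal ((mu - a) / mu * Real.exp (-a * blockWalk x b (n + 1)))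
          ∂blockLaw lam mu := by
  let g : ℝ → ℝ≥0∞ := fun w => ENNReal.ofReal ((mu - a) / mu * Real.exp (-a * w))
  let h : ℝ≥0∞ × ℝ → ℝ → ℝ → ℝ≥0∞ := fun y u d =>
    y.1 * (ENNReal.ofReal (Real.exp (2 * s * u)) *
      (if y.2 + u - d ≤ 0 then 1 else g (y.2 + u - d)))
  have hh : Measurable fun p : (ℝ≥0∞ × ℝ) × (ℝ × ℝ) => h p.1 p.2.1 p.2.2 := by
    refine measurable_fst.fst.mul (Measurable.mul (by fun_prop) ?_)
    refine Measurable.ite (measurableSet_le (by fun_prop) measurable_const) measurable_const ?_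
    simp only [g]; fun_prop
  have hcyc := lintegral_blockLaw_cycle hlam hmu n
    (f := fun b => (survivalWeight x s n b, blockWalk x b n)) (by fun_prop)
    (fun b b' hb => by rw [survivalWeight_congr hb, blockWalk_congr le_rfl hb]) hh
  have hleft : ∀ b, survivalWeight x s n b *
      ENNReal.ofReal ((mu - a) / mu * Real.exp (-a * blockWalk x b n))
      = ∫⁻ u, ∫⁻ d, h (survivalWeight x s n b, blockWalk x b n) u d
          ∂expMeasure mu ∂expMeasure lam := fun b => by
    -- The one-cycle equation needs a nonnegative height; where this fails the weight vanishes.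
    rcases survivalWeight_eq_zero_or_nonneg (s := s) hx n b with h0 | h0
    · simp [h, h0]
    · have hne : survivalWeight x s n b ≠ ⊤ := by unfold survivalWeight; split_ifs <;> simp
      rw [← lintegral_cycle_harmonic hlam hmu ha ha' hroot h0, ← lintegral_const_mul' _ _ hne]
      exact lintegral_congr fun u => (lintegral_const_mul' _ _ hne).symm
  rw [lintegral_congr hleft, ← hcyc, ← lintegral_indicator (measurableSet_arrivalCycle x n),
    ← lintegral_add_left
      (Measurable.indicator (by fun_prop) (measurableSet_arrivalCycle x n))]
  refine lintegral_congr fun b => ?_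
  rw [← survivalWeight_mul_exp x s n b g, blockWalk_succ]

/-- Dropping the killing in the last cycle only increases the integral, and a free cycle multiplies
it by the eigenvalue of `lintegral_cycle`. -/
lemma lintegral_survivalWeight_le {lam mu s c x : ℝ} (hlam : 0 < lam) (hmu : 0 < mu)
    (hc : c < mu) (hc' : 2 * s - c < lam) (n : ℕ) :
    ∫⁻ b, survivalWeight x s n b * ENNReal.ofReal (Real.exp (-c * blockWalk x b n))
        ∂blockLaw lam mu
      ≤ ENNReal.ofReal (lam * mu / ((lam - 2 * s + c) * (mu - c))) ^ n *
        ENNReal.ofReal (Real.exp (-c * x)) := by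
  have := isProbabilityMeasure_blockLaw hlam hmu
  induction n with
  | zero => simp [survivalWeight_zero, blockWalk_zero]
  | succ n ih =>
    let h : ℝ≥0∞ × ℝ → ℝ → ℝ → ℝ≥0∞ := fun y u d =>
      y.1 * (ENNReal.ofReal (Real.exp (2 * s * u)) * ENNReal.ofReal (Real.exp (-c * (y.2 + u - d))))
    have hh : Measurable fun p : (ℝ≥0∞ × ℝ) × (ℝ × ℝ) => h p.1 p.2.1 p.2.2 := by
      simp only [h]; fun_prop
    have hcyc := lintegral_blockLaw_cycle hlam hmu n
      (f := fun b => (survivalWeight x s n b, blockWalk x b n)) (by fun_prop)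
      (fun b b' hb => by rw [survivalWeight_congr hb, blockWalk_congr le_rfl hb]) hh
    have h1 : 0 < lam - 2 * s + c := by linarith
    have h2 : 0 < mu - c := by linarith
    have hright : ∀ b, ∫⁻ u, ∫⁻ d, h (survivalWeight x s n b, blockWalk x b n) u d
        ∂expMeasure mu ∂expMeasure lam
        = ENNReal.ofReal (lam * mu / ((lam - 2 * s + c) * (mu - c))) *
          (survivalWeight x s n b * ENNReal.ofReal (Real.exp (-c * blockWalk x b n))) := fun b => by
      have hne : survivalWeight x s n b ≠ ⊤ := by unfold survivalWeight; split_ifs <;> simp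
      rw [mul_left_comm, ← ENNReal.ofReal_mul (by positivity), ← lintegral_cycle hlam hmu hc hc',
        ← lintegral_const_mul' _ _ hne]
      exact lintegral_congr fun u => lintegral_const_mul' _ _ hne
    calc _ ≤ ∫⁻ b, h (survivalWeight x s n b, blockWalk x b n) (b (Sum.inl n)) (b (Sum.inr n))
            ∂blockLaw lam mu := by
          refine lintegral_mono fun b => ?_
          simp only [h]
          rw [← blockWalk_succ, ← mul_assoc]
          gcongr
          exact survivalWeight_succ_le x s n b
      _ = ENNReal.ofReal (lam * mu / ((lam - 2 * s + c) * (mu - c))) *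
          ∫⁻ b, survivalWeight x s n b * ENNReal.ofReal (Real.exp (-c * blockWalk x b n))
            ∂blockLaw lam mu := by
          rw [hcyc, lintegral_congr hright, lintegral_const_mul' _ _ ENNReal.ofReal_ne_top]
      _ ≤ _ := by
          rw [pow_succ', mul_assoc]
          gcongr

/-- The moment generating function of the total duration of the upward phases until the first
arrival at the origin. -/
lemma tsum_lintegral_arrivalCycle {lam mu s a c x : ℝ} (hlam : 0 < lam) (hmu : 0 < mu)
    (ha : a < mu) (ha' : 2 * s - a < lam) (hroot : (lam - 2 * s + a) * (mu - a) = lam * mu)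
    (hca : c ≤ a) (hc' : 2 * s - c < lam) (hlt : lam * mu < (lam - 2 * s + c) * (mu - c))
    (hx : 0 ≤ x) :
    ∑' n, ∫⁻ b in arrivalCycle x n, ENNReal.ofReal
        (Real.exp (2 * s * ∑ k ∈ Finset.range (n + 1), b (Sum.inl k))) ∂blockLaw lam mu
      = ENNReal.ofReal ((mu - a) / mu * Real.exp (-a * x)) := by
  have := isProbabilityMeasure_blockLaw hlam hmu
  set H : ℕ → ℝ≥0∞ := fun n => ∫⁻ b in arrivalCycle x n, ENNReal.ofReal
    (Real.exp (2 * s * ∑ k ∈ Finset.range (n + 1), b (Sum.inl k))) ∂blockLaw lam mu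
  set R : ℕ → ℝ≥0∞ := fun n => ∫⁻ b, survivalWeight x s n b *
    ENNReal.ofReal ((mu - a) / mu * Real.exp (-a * blockWalk x b n)) ∂blockLaw lam mu with hR
  have hstep : ∀ n, R n = H n + R (n + 1) := fun n =>
    lintegral_survivalWeight_succ hlam hmu ha ha' hroot hx n
  have hR0 : R 0 = ENNReal.ofReal ((mu - a) / mu * Real.exp (-a * x)) := by
    simp [hR, survivalWeight_zero, blockWalk_zero]
  have hsum : ∀ n, R 0 = ∑ k ∈ Finset.range n, H k + R n := fun n => by
    induction n with
    | zero => simp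
    | succ n ih => rw [ih, hstep n, Finset.sum_range_succ, add_assoc]
  have hr : ENNReal.ofReal (lam * mu / ((lam - 2 * s + c) * (mu - c))) < 1 := by
    rw [← ENNReal.ofReal_one, ENNReal.ofReal_lt_ofReal_iff one_pos,
      div_lt_one ((mul_pos hlam hmu).trans hlt)]
    exact hlt
  -- The eigenvalue at `a` itself is one and gives no decay. On surviving paths the height is
  -- nonnegative, so `c ≤ a` allows `exp (-a w)` to be replaced by the larger `exp (-c w)`.
  have hbound : ∀ n, R n ≤ ENNReal.ofReal ((mu - a) / mu) *
      (ENNReal.ofReal (lam * mu / ((lam - 2 * s + c) * (mu - c))) ^ n *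
        ENNReal.ofReal (Real.exp (-c * x))) := fun n => by
    have hmua : 0 ≤ (mu - a) / mu := div_nonneg (by linarith) hmu.le
    refine le_trans ?_ (mul_le_mul_right (lintegral_survivalWeight_le (x := x) hlam hmu
      (hca.trans_lt ha) hc' n) _)
    rw [← lintegral_const_mul' _ _ ENNReal.ofReal_ne_top]
    refine lintegral_mono fun b => ?_
    rcases survivalWeight_eq_zero_or_nonneg (s := s) hx n b with h0 | h0
    · simp [h0]
    · rw [mul_left_comm, ← ENNReal.ofReal_mul hmua]
      gcongr
  have hlim : Tendsto R atTop (𝓝 0) := by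
    refine tendsto_of_tendsto_of_tendsto_of_le_of_le tendsto_const_nhds ?_ (fun _ => zero_le) hbound
    have h1 := ENNReal.Tendsto.mul_const (ENNReal.tendsto_pow_atTop_nhds_zero_of_lt_one hr)
      (b := ENNReal.ofReal (Real.exp (-c * x))) (Or.inr ENNReal.ofReal_ne_top)
    have h2 := ENNReal.Tendsto.const_mul h1 (a := ENNReal.ofReal ((mu - a) / mu))
      (Or.inr ENNReal.ofReal_ne_top)
    simpa using h2
  have hlim' := (ENNReal.tendsto_nat_tsum H).add hlim
  rw [add_zero] at hlim'
  rw [← hR0]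
  refine tendsto_nhds_unique hlim' ?_
  exact tendsto_const_nhds.congr hsum

/-- The parameters of the exponential martingales of the walk. -/
lemma exists_exponents {lam mu s : ℝ} (hlam : 0 < lam) (hmu : 0 < mu)
    (hs : 0 < lam + mu - 2 * s) (hdisc : 4 * lam * mu < (lam + mu - 2 * s) ^ 2) :
    s - telegraphLambda s lam mu < mu ∧ 2 * s - (s - telegraphLambda s lam mu) < lam ∧
      (lam - 2 * s + (s - telegraphLambda s lam mu)) * (mu - (s - telegraphLambda s lam mu))
        = lam * mu ∧
      ∃ c ≤ s - telegraphLambda s lam mu, 2 * s - c < lam ∧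
        lam * mu < (lam - 2 * s + c) * (mu - c) := by
  have hsq := Real.sq_sqrt (show 0 ≤ (lam + mu - 2 * s) ^ 2 - 4 * lam * mu by linarith)
  have hpos := Real.sqrt_pos.2 (show 0 < (lam + mu - 2 * s) ^ 2 - 4 * lam * mu by linarith)
  unfold telegraphLambda
  set q := Real.sqrt ((lam + mu - 2 * s) ^ 2 - 4 * lam * mu)
  have hq : q < lam + mu - 2 * s := by
    have := mul_pos hlam hmu
    by_contra! h
    nlinarith
  -- `s - Λ` is the larger root of the quadratic equation; `c` is the midpoint of the two roots,
  -- where the product is maximal.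
  refine ⟨by linarith, by linarith, by linear_combination -hsq / 4, (mu - lam + 2 * s) / 2,
    by linarith, by linarith, by linarith⟩

/-- Almost surely the motion arrives at the origin, and the arrival time is determined by the total
duration of the upward phases. -/
lemma ae_exists_mem_arrivalCycle {lam mu x : ℝ} (hmu : 0 < mu) (hlt : mu < lam) (hx : 0 ≤ x) :
    ∀ᵐ b ∂blockLaw lam mu, b ∈ ⋃ n, arrivalCycle x n := by
  have hlam := hmu.trans hlt
  have := isProbabilityMeasure_blockLaw hlam hmu
  have hdisc : 4 * lam * mu < (lam + mu - 2 * 0) ^ 2 := by nlinarith [sq_pos_of_pos (sub_pos.2 hlt)]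
  obtain ⟨ha, ha', hroot, c, hca, hc', hr⟩ :=
    exists_exponents hlam hmu (s := 0) (by linarith) hdisc
  have h0 : telegraphLambda 0 lam mu = 0 := by
    unfold telegraphLambda
    rw [show (lam + mu - 2 * 0) ^ 2 - 4 * lam * mu = (lam - mu) ^ 2 by ring,
      Real.sqrt_sq (sub_pos.2 hlt).le]
    simp
  -- At `s = 0` the exponent `a` is zero, and the formula says that the probabilities of the arrival
  -- cycles add up to one.
  have h := tsum_lintegral_arrivalCycle hlam hmu ha ha' hroot hca hc' hr hx
  simp only [h0, mul_zero, zero_mul, Real.exp_zero, sub_zero, neg_zero, ENNReal.ofReal_one,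
    div_self hmu.ne', one_mul, setLIntegral_one] at h
  rw [← measure_iUnion (pairwise_disjoint_arrivalCycle x) (measurableSet_arrivalCycle x)] at h
  exact (prob_compl_eq_zero_iff (MeasurableSet.iUnion (measurableSet_arrivalCycle x))).2 h

lemma blockArrival_ae_eq_on_arrivalCycle {lam mu x : ℝ} (hlam : 0 < lam) (hmu : 0 < mu)
    (hx : 0 ≤ x) (n : ℕ) :
    ∀ᵐ b ∂(blockLaw lam mu).restrict (arrivalCycle x n),
      blockArrival x b = x + 2 * ∑ k ∈ Finset.range (n + 1), b (Sum.inl k) := by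
  rw [ae_restrict_iff' (measurableSet_arrivalCycle x n)]
  filter_upwards [ae_pos_blockLaw hlam hmu] with b hb hbn
  exact firstArrival_eq hx (fun k => hb _) (fun k => hb _) hbn.1 hbn.2

/-- The infimum defining the arrival time is not visibly measurable, but on each of the countably
many arrival cycles it agrees almost surely with a finite sum of phases. -/
lemma aemeasurable_blockArrival {lam mu x : ℝ} (hmu : 0 < mu) (hlt : mu < lam) (hx : 0 ≤ x) :
    AEMeasurable (blockArrival x) (blockLaw lam mu) := by
  rw [← Measure.restrict_eq_self_of_ae_mem (ae_exists_mem_arrivalCycle hmu hlt hx),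
    aemeasurable_iUnion_iff]
  exact fun n => AEMeasurable.congr (Measurable.aemeasurable (by fun_prop))
    (EventuallyEq.symm (blockArrival_ae_eq_on_arrivalCycle (hmu.trans hlt) hmu hx n))

/-- The moment generating function of the first arrival time at the origin. -/
theorem lintegral_exp_blockArrival {lam mu s x : ℝ} (hmu : 0 < mu) (hlt : mu < lam)
    (hs : 0 < lam + mu - 2 * s) (hdisc : 4 * lam * mu < (lam + mu - 2 * s) ^ 2) (hx : 0 ≤ x) :
    ∫⁻ b, ENNReal.ofReal (Real.exp (s * blockArrival x b)) ∂blockLaw lam mu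
      = ENNReal.ofReal ((mu - s + telegraphLambda s lam mu) / mu *
          Real.exp (x * telegraphLambda s lam mu)) := by
  have hlam := hmu.trans hlt
  obtain ⟨ha, ha', hroot, c, hca, hc', hr⟩ := exists_exponents hlam hmu hs hdisc
  have h := tsum_lintegral_arrivalCycle hlam hmu ha ha' hroot hca hc' hr hx
  have hn : ∀ n, ∫⁻ b in arrivalCycle x n, ENNReal.ofReal (Real.exp (s * blockArrival x b))
      ∂blockLaw lam mu = ENNReal.ofReal (Real.exp (s * x)) *
        ∫⁻ b in arrivalCycle x n, ENNReal.ofReal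
          (Real.exp (2 * s * ∑ k ∈ Finset.range (n + 1), b (Sum.inl k))) ∂blockLaw lam mu := fun n => by
    rw [← lintegral_const_mul' _ _ ENNReal.ofReal_ne_top]
    refine lintegral_congr_ae ?_
    filter_upwards [blockArrival_ae_eq_on_arrivalCycle hlam hmu hx n] with b hb
    rw [hb, ← ENNReal.ofReal_mul (by positivity), ← Real.exp_add]
    ring_nf
  rw [← Measure.restrict_eq_self_of_ae_mem (ae_exists_mem_arrivalCycle hmu hlt hx),
    lintegral_iUnion (measurableSet_arrivalCycle x) (pairwise_disjoint_arrivalCycle x)]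
  simp_rw [hn]
  -- Since `a = s - Λ`, the exponents combine as `s x - a x = x Λ`.
  rw [ENNReal.tsum_mul_left, h, ← ENNReal.ofReal_mul (by positivity), mul_left_comm,
    ← Real.exp_add]
  ring_nf

/-! ### The moment generating function of the absorption time -/

/-- The phases, grouped according to the visits to the origin. -/
def phaseBlocks {Ω : Type*} (U D : ℕ → ℕ → Ω → ℝ) (ω : Ω) (i : ℕ) : ℕ ⊕ ℕ → ℝ :=
  Sum.elim (fun k => U i k ω) fun k => D i k ω

lemma absorptionTime_eq_sum_range {Ω : Type*} {x : ℝ} {M : Ω → ℕ} {U D : ℕ → ℕ → Ω → ℝ} {ω : Ω}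
    (hM : 1 ≤ M ω) :
    absorptionTime x M U D ω
      = ∑ i ∈ Finset.range (M ω), blockArrival (if i = 0 then x else 0) (phaseBlocks U D ω i) := by
  obtain ⟨m, hm⟩ := Nat.exists_eq_add_of_le' hM
  have hIcc : Finset.Icc 1 m = Finset.Ico (0 + 1) (m + 1) := by ext i; simp
  rw [hm, Finset.sum_range_succ', add_comm, absorptionTime, hm, Nat.add_sub_cancel, hIcc,
    ← Finset.sum_Ico_add', ← Finset.range_eq_Ico]
  simp [phaseBlocks, blockArrival]

/-- The index of a phase, from the index of its block and its index in the block. -/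
def phaseIndex (p : ℕ × (ℕ ⊕ ℕ)) : ℕ × ℕ ⊕ ℕ × ℕ :=
  Sum.map (fun k => (p.1, k)) (fun k => (p.1, k)) p.2

lemma phaseIndex_injective : Function.Injective phaseIndex := by
  rintro ⟨i, k | k⟩ ⟨j, l | l⟩ h <;> simp_all [phaseIndex]

lemma phaseBlocks_eq {Ω : Type*} (U D : ℕ → ℕ → Ω → ℝ) :
    phaseBlocks U D = (fun b : ℕ × ℕ ⊕ ℕ × ℕ → ℝ => fun i j => b (phaseIndex (i, j))) ∘
      fun ω j => Sum.elim (fun p : ℕ × ℕ => U p.1 p.2) (fun p : ℕ × ℕ => D p.1 p.2) j ω := by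
  ext ω i (k | k) <;> rfl

section Absorption

variable {Ω : Type*} [MeasurableSpace Ω] {P : Measure Ω} {lam mu x : ℝ} {M : Ω → ℕ}
  {U D : ℕ → ℕ → Ω → ℝ}

lemma IsTelegraphModel.aemeasurable_phases (h : IsTelegraphModel P lam mu M U D)
    (j : ℕ × ℕ ⊕ ℕ × ℕ) :
    AEMeasurable (Sum.elim (fun p : ℕ × ℕ => U p.1 p.2) (fun p : ℕ × ℕ => D p.1 p.2) j) P := by
  rcases j with p | p
  · exact (h.law_up p.1 p.2).aemeasurable
  · exact (h.law_down p.1 p.2).aemeasurable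

lemma IsTelegraphModel.aemeasurable_phaseBlocks (h : IsTelegraphModel P lam mu M U D) :
    AEMeasurable (phaseBlocks U D) P := by
  rw [phaseBlocks_eq]
  exact Measurable.comp_aemeasurable (by fun_prop) (aemeasurable_pi_lambda _ h.aemeasurable_phases)

lemma IsTelegraphModel.indepFun_phaseBlocks (h : IsTelegraphModel P lam mu M U D) :
    IndepFun M (phaseBlocks U D) P := by
  rw [phaseBlocks_eq]
  exact h.indep_count.comp (φ := id) measurable_id (by fun_prop)

lemma IsTelegraphModel.map_phaseBlocks [IsProbabilityMeasure P]
    (h : IsTelegraphModel P lam mu M U D) (hlam : 0 < lam) (hmu : 0 < mu) :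
    P.map (phaseBlocks U D) = Measure.infinitePi fun _ => blockLaw lam mu := by
  have hphase := isProbabilityMeasure_phaseLaw hlam hmu
  set κ : ℕ × ℕ ⊕ ℕ × ℕ → Measure ℝ :=
    Sum.elim (fun _ => expMeasure lam) fun _ => expMeasure mu with hκ
  have hprob : ∀ j, IsProbabilityMeasure (κ j) := by
    rintro (j | j)
    · exact isProbabilityMeasure_expMeasure hlam
    · exact isProbabilityMeasure_expMeasure hmu
  have hlaw : (fun j => P.map
      (Sum.elim (fun p : ℕ × ℕ => U p.1 p.2) (fun p : ℕ × ℕ => D p.1 p.2) j)) = κ := by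
    ext1 j
    rcases j with p | p
    · exact (h.law_up p.1 p.2).map_eq
    · exact (h.law_down p.1 p.2).map_eq
  have hmap := h.indep_phases.map_fun_eq_infinitePi_map₀' h.aemeasurable_phases
  rw [hlaw] at hmap
  -- Grouping into blocks is an injective reindexing followed by currying, and both carry product
  -- measures to product measures.
  have hcurry : (fun b : ℕ × ℕ ⊕ ℕ × ℕ → ℝ => fun i j => b (phaseIndex (i, j)))
      = (MeasurableEquiv.curry ℕ (ℕ ⊕ ℕ) ℝ) ∘ fun b p => b (phaseIndex p) := rfl
  have hκ' : ∀ p, κ (phaseIndex p) = phaseLaw lam mu p.2 := by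
    rintro ⟨i, j | j⟩ <;> rfl
  rw [phaseBlocks_eq, ← AEMeasurable.map_map_of_aemeasurable
    (Measurable.aemeasurable (by fun_prop)) (aemeasurable_pi_lambda _ h.aemeasurable_phases), hmap,
    hcurry, ← Measure.map_map (by fun_prop) (by fun_prop),
    Measure.map_infinitePi_infinitePi_of_inj phaseIndex_injective]
  simp_rw [hκ']
  exact Measure.infinitePi_map_curry fun _ : ℕ => phaseLaw lam mu

/-- The arrival times are almost surely equal to measurable functions of the blocks. -/
lemma exists_measurable_absorptionTime_ae_eq [IsProbabilityMeasure P]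
    (h : IsTelegraphModel P lam mu M U D) (hM : IsLightTailedCount P M) (hmu : 0 < mu)
    (hlt : mu < lam) (hx : 0 ≤ x) :
    ∃ C : ℕ → (ℕ ⊕ ℕ → ℝ) → ℝ, (∀ i, Measurable (C i)) ∧
      (∀ i, C i =ᵐ[blockLaw lam mu] blockArrival (if i = 0 then x else 0)) ∧
      absorptionTime x M U D =ᵐ[P]
        fun ω => ∑ i ∈ Finset.range (M ω), C i (phaseBlocks U D ω i) := by
  have hlam := hmu.trans hlt
  have := isProbabilityMeasure_blockLaw hlam hmu
  have hae : ∀ i : ℕ, AEMeasurable (blockArrival (if i = 0 then x else 0)) (blockLaw lam mu) :=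
    fun i => aemeasurable_blockArrival hmu hlt (by split_ifs; exacts [hx, le_rfl])
  refine ⟨fun i => (hae i).mk _, fun i => (hae i).measurable_mk, fun i => (hae i).ae_eq_mk.symm, ?_⟩
  have hmap := h.map_phaseBlocks hlam hmu
  -- All blocks are treated at once, so that one null set serves the random number of summands.
  have hall : ∀ᵐ b ∂P.map (phaseBlocks U D), ∀ i : ℕ,
      blockArrival (if i = 0 then x else 0) (b i) = (hae i).mk _ (b i) := by
    rw [hmap, ae_all_iff]
    exact fun i => (measurePreserving_eval_infinitePi (fun _ => blockLaw lam mu)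
      i).quasiMeasurePreserving.ae (hae i).ae_eq_mk
  filter_upwards [hM.pos, ae_of_ae_map h.aemeasurable_phaseBlocks hall] with ω h1 h2
  rw [absorptionTime_eq_sum_range h1]
  exact Finset.sum_congr rfl fun i _ => h2 i

lemma measurable_sum_range_blocks {C : ℕ → (ℕ ⊕ ℕ → ℝ) → ℝ} (hC : ∀ i, Measurable (C i)) :
    Measurable fun p : ℕ × (ℕ → ℕ ⊕ ℕ → ℝ) => ∑ i ∈ Finset.range p.1, C i (p.2 i) :=
  measurable_from_prod_countable_right fun m =>
    Finset.measurable_fun_sum (Finset.range m) fun i _ => (hC i).comp (measurable_pi_apply i)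

lemma aemeasurable_absorptionTime [IsProbabilityMeasure P]
    (h : IsTelegraphModel P lam mu M U D) (hM : IsLightTailedCount P M) (hmu : 0 < mu)
    (hlt : mu < lam) (hx : 0 ≤ x) : AEMeasurable (absorptionTime x M U D) P := by
  obtain ⟨C, hC, -, hA⟩ := exists_measurable_absorptionTime_ae_eq h hM hmu hlt hx
  exact ((measurable_sum_range_blocks hC).comp_aemeasurable
    (hM.aemeasurable.prodMk h.aemeasurable_phaseBlocks)).congr hA.symm

/-- The moment generating function of the absorption time at the origin. -/
theorem lintegral_exp_absorptionTime [IsProbabilityMeasure P] {s : ℝ}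
    (h : IsTelegraphModel P lam mu M U D) (hM : IsLightTailedCount P M) (hmu : 0 < mu)
    (hlt : mu < lam) (hs : 0 < lam + mu - 2 * s)
    (hdisc : 4 * lam * mu < (lam + mu - 2 * s) ^ 2) (hx : 0 ≤ x) :
    ∫⁻ ω, ENNReal.ofReal (Real.exp (s * absorptionTime x M U D ω)) ∂P
      = ENNReal.ofReal (Real.exp (x * telegraphLambda s lam mu)) *
        ∫⁻ ω, ENNReal.ofReal (((mu - s + telegraphLambda s lam mu) / mu) ^ M ω) ∂P := by
  have hlam := hmu.trans hlt
  have := isProbabilityMeasure_blockLaw hlam hmu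
  obtain ⟨C, hC, hCae, hA⟩ := exists_measurable_absorptionTime_ae_eq h hM hmu hlt hx
  set φ := (mu - s + telegraphLambda s lam mu) / mu with hφ_def
  have hφ : 0 ≤ φ := by
    obtain ⟨ha, -⟩ := exists_exponents hlam hmu hs hdisc
    exact div_nonneg (by linarith) hmu.le
  let F : ℕ × (ℕ → ℕ ⊕ ℕ → ℝ) → ℝ≥0∞ := fun p =>
    ENNReal.ofReal (Real.exp (s * ∑ i ∈ Finset.range p.1, C i (p.2 i)))
  have hF : Measurable F :=
    (((measurable_sum_range_blocks hC).const_mul s).exp).ennreal_ofReal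
  have hpair := hM.aemeasurable.prodMk h.aemeasurable_phaseBlocks
  have hlaw := h.indepFun_phaseBlocks.map_prod_eq_prod_map_map hM.aemeasurable
    h.aemeasurable_phaseBlocks
  rw [h.map_phaseBlocks hlam hmu] at hlaw
  have hindep : iIndepFun (fun (i : ℕ) (b : ℕ → ℕ ⊕ ℕ → ℝ) =>
      ENNReal.ofReal (Real.exp (s * C i (b i)))) (Measure.infinitePi fun _ => blockLaw lam mu) :=
    iIndepFun_infinitePi (X := fun i b => ENNReal.ofReal (Real.exp (s * C i b)))
      fun i => by have := hC i; fun_prop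
  have hfactor : ∀ i, ∫⁻ b, ENNReal.ofReal (Real.exp (s * C i (b i)))
      ∂(Measure.infinitePi fun _ : ℕ => blockLaw lam mu)
      = ENNReal.ofReal (φ * Real.exp ((if i = 0 then x else 0) * telegraphLambda s lam mu)) :=
    fun i => by
      have hm : Measurable fun b => ENNReal.ofReal (Real.exp (s * C i b)) := by
        have := hC i; fun_prop
      rw [← lintegral_exp_blockArrival hmu hlt hs hdisc (by split_ifs; exacts [hx, le_rfl]),
        (measurePreserving_eval_infinitePi (fun _ : ℕ => blockLaw lam mu) i).lintegral_comp hm]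
      refine lintegral_congr_ae ?_
      filter_upwards [hCae i] with b hb
      rw [hb]
  -- For a fixed number `m` of visits each of the independent blocks contributes `φ`, and block 0,
  -- the only one started at `x`, contributes the extra exponential.
  have hinner : ∀ m, 1 ≤ m → ∫⁻ b, F (m, b) ∂(Measure.infinitePi fun _ : ℕ => blockLaw lam mu)
      = ENNReal.ofReal (Real.exp (x * telegraphLambda s lam mu)) * ENNReal.ofReal (φ ^ m) := by
    intro m hm
    obtain ⟨m, rfl⟩ := Nat.exists_eq_add_of_le' hm
    have : ∀ b, F (m + 1, b)
        = ∏ i ∈ Finset.range (m + 1), ENNReal.ofReal (Real.exp (s * C i (b i))) := fun b => by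
      simp only [F]
      rw [Finset.mul_sum, Real.exp_sum, ENNReal.ofReal_prod_of_nonneg fun i _ => by positivity]
    simp_rw [this]
    rw [lintegral_prod_eq_prod_lintegral_of_indepFun _ _ hindep
      fun i => by have := hC i; fun_prop]
    simp_rw [hfactor]
    rw [Finset.prod_range_succ']
    simp only [Nat.add_eq_zero_iff, one_ne_zero, and_false, if_false, if_true, zero_mul,
      Real.exp_zero, mul_one, Finset.prod_const, Finset.card_range]
    rw [← ENNReal.ofReal_pow hφ, ← ENNReal.ofReal_mul (by positivity),
      ← ENNReal.ofReal_mul (by positivity)]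
    ring_nf
  have hM1 : ∀ᵐ m ∂P.map M, 1 ≤ m :=
    (ae_map_iff hM.aemeasurable (measurableSet_le measurable_const measurable_id)).2 hM.pos
  have hMprob : IsProbabilityMeasure (P.map M) := Measure.isProbabilityMeasure_map hM.aemeasurable
  calc _ = ∫⁻ ω, F (M ω, phaseBlocks U D ω) ∂P := by
        refine lintegral_congr_ae ?_
        filter_upwards [hA] with ω hω
        rw [hω]
    _ = ∫⁻ p, F p ∂(P.map fun ω => (M ω, phaseBlocks U D ω)) :=
        (lintegral_map' hF.aemeasurable hpair).symm
    _ = ∫⁻ m, ∫⁻ b, F (m, b) ∂(Measure.infinitePi fun _ : ℕ => blockLaw lam mu) ∂P.map M := by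
        rw [hlaw, lintegral_prod _ hF.aemeasurable]
    _ = ∫⁻ m, ENNReal.ofReal (Real.exp (x * telegraphLambda s lam mu)) * ENNReal.ofReal (φ ^ m)
          ∂P.map M := by
        refine lintegral_congr_ae ?_
        filter_upwards [hM1] with m hm using hinner m hm
    _ = _ := by
        rw [lintegral_const_mul _ (by fun_prop),
          lintegral_map' (Measurable.aemeasurable (by fun_prop)) hM.aemeasurable]

end Absorption

/-! ### The Gärtner–Ellis theorem for a quadratic limit on the real line -/

section GartnerEllis

variable {Ω : Type*} [MeasurableSpace Ω] {P : Measure Ω} [IsProbabilityMeasure P]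
  {Z : ℝ → Ω → ℝ} {ε : ℝ → ℝ} {v : ℝ}

/-- Chernoff bound at the tilt `z / v`, which maximises `θ z - v θ² / 2`. -/
lemma eventually_measureReal_ge_le_exp (hv : 0 < v) (hε : ∀ᶠ r in atTop, 0 < ε r)
    (hint : ∀ θ, ∀ᶠ r in atTop, Integrable (fun ω => Real.exp (θ / ε r * Z r ω)) P)
    (hlim : ∀ θ, Tendsto (fun r => ε r * cgf (Z r) P (θ / ε r)) atTop (𝓝 (v * θ ^ 2 / 2)))
    {z η : ℝ} (hz : 0 ≤ z) (hη : 0 < η) :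
    ∀ᶠ r in atTop, P.real {ω | z ≤ Z r ω} ≤ Real.exp ((-(z ^ 2 / (2 * v)) + η) / ε r) := by
  have hlt : v * (z / v) ^ 2 / 2 < z ^ 2 / (2 * v) + η := by
    have : v * (z / v) ^ 2 / 2 = z ^ 2 / (2 * v) := by field_simp
    linarith
  filter_upwards [hε, hint (z / v), (hlim (z / v)).eventually_lt_const hlt] with r hr hi hc
  refine (measure_ge_le_exp_cgf z (by positivity) hi).trans (Real.exp_le_exp.2 ?_)
  rw [le_div_iff₀ hr]
  have h1 : z / v / ε r * z * ε r = 2 * (z ^ 2 / (2 * v)) := by field_simp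
  linarith

lemma eventually_measureReal_le_le_exp (hv : 0 < v) (hε : ∀ᶠ r in atTop, 0 < ε r)
    (hint : ∀ θ, ∀ᶠ r in atTop, Integrable (fun ω => Real.exp (θ / ε r * Z r ω)) P)
    (hlim : ∀ θ, Tendsto (fun r => ε r * cgf (Z r) P (θ / ε r)) atTop (𝓝 (v * θ ^ 2 / 2)))
    {z η : ℝ} (hz : 0 ≤ z) (hη : 0 < η) :
    ∀ᶠ r in atTop, P.real {ω | Z r ω ≤ -z} ≤ Real.exp ((-(z ^ 2 / (2 * v)) + η) / ε r) := by
  have h := eventually_measureReal_ge_le_exp (Z := fun r => -Z r) hv hε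
    (fun θ => (hint (-θ)).mono fun r hr => by simpa [neg_div] using hr)
    (fun θ => by simpa [cgf_neg, neg_div] using hlim (-θ)) hz hη
  filter_upwards [h] with r hr
  simpa [le_neg] using hr

/-- The moment generating function at the tilt `t` optimal for `z` is split into the window around
`z` and the two outer parts. The outer parts are dominated by the values at the tilts `t ± s` and
are at most a quarter of the total each, so the window carries at least half. On the window `exp (t
Z)` is at most `exp (t z + |t| δ)`; the loss `|z| δ / v` is covered by `η`. -/
lemma eventually_exp_le_measureReal_abs_sub_lt (hv : 0 < v) (hε : ∀ᶠ r in atTop, 0 < ε r)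
    (hε0 : Tendsto ε atTop (𝓝 0)) (hZ : ∀ᶠ r in atTop, AEMeasurable (Z r) P)
    (hint : ∀ θ, ∀ᶠ r in atTop, Integrable (fun ω => Real.exp (θ / ε r * Z r ω)) P)
    (hlim : ∀ θ, Tendsto (fun r => ε r * cgf (Z r) P (θ / ε r)) atTop (𝓝 (v * θ ^ 2 / 2)))
    {z δ η : ℝ} (hδ : 0 < δ) (hη : |z| * δ / v < η) :
    ∀ᶠ r in atTop, Real.exp ((-(z ^ 2 / (2 * v)) - η) / ε r) ≤ P.real {ω | |Z r ω - z| < δ} := by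
  have hlog : ∀ c : ℝ, Tendsto (fun r => ε r * c) atTop (𝓝 0) := fun c => by
    simpa using hε0.mul_const c
  -- The shift `δ / v` is optimal for the excess `δ` beyond `z`; it leaves a gap `δ² / (2 v)`, which
  -- absorbs `ε log 4`.
  have hup : ∀ᶠ r in atTop, -(δ / v * (z + δ)) + ε r * cgf (Z r) P ((z / v + δ / v) / ε r)
      + ε r * Real.log 4 < ε r * cgf (Z r) P (z / v / ε r) := by
    refine (((hlim (z / v + δ / v)).const_add _).add (hlog _)).eventually_lt (hlim (z / v)) ?_
    have : v * (z / v) ^ 2 / 2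
        - (-(δ / v * (z + δ)) + v * (z / v + δ / v) ^ 2 / 2 + 0) = δ ^ 2 / (2 * v) := by
      field_simp; ring
    have : 0 < δ ^ 2 / (2 * v) := by positivity
    linarith
  have hdown : ∀ᶠ r in atTop, δ / v * (z - δ) + ε r * cgf (Z r) P ((z / v - δ / v) / ε r)
      + ε r * Real.log 4 < ε r * cgf (Z r) P (z / v / ε r) := by
    refine (((hlim (z / v - δ / v)).const_add _).add (hlog _)).eventually_lt (hlim (z / v)) ?_
    have : v * (z / v) ^ 2 / 2
        - (δ / v * (z - δ) + v * (z / v - δ / v) ^ 2 / 2 + 0) = δ ^ 2 / (2 * v) := by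
      field_simp; ring
    have : 0 < δ ^ 2 / (2 * v) := by positivity
    linarith
  have hmid : ∀ᶠ r in atTop, -(z ^ 2 / (2 * v)) - η
      < ε r * cgf (Z r) P (z / v / ε r) - ε r * Real.log 2 - z ^ 2 / v - |z| * δ / v := by
    refine Tendsto.eventually_const_lt ?_
      ((((hlim (z / v)).sub (hlog _)).sub_const (z ^ 2 / v)).sub_const (|z| * δ / v))
    have : v * (z / v) ^ 2 / 2 - z ^ 2 / v = -(z ^ 2 / (2 * v)) := by field_simp; ring
    linarith
  filter_upwards [hε, hZ, hint (z / v), hint (z / v + δ / v), hint (z / v - δ / v), hup, hdown,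
    hmid] with r hr hZr hi1 hi2 hi3 h1 h2 h3
  set t := z / v / ε r with ht
  set s := δ / v / ε r with hs
  have hts : (z / v + δ / v) / ε r = t + s := add_div _ _ _
  have hts' : (z / v - δ / v) / ε r = t - s := sub_div _ _ _
  rw [hts] at hi2 h1
  rw [hts'] at hi3 h2
  have hs0 : 0 < s := by positivity
  have hεt : ε r * t = z / v := by rw [ht]; field_simp
  have hεs : ε r * s = δ / v := by rw [hs]; field_simp
  have hpt : ∀ ω, Real.exp (t * Z r ω) ≤
      Set.indicator {ω | |Z r ω - z| < δ} (fun _ => Real.exp (t * z + |t| * δ)) ω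
        + Real.exp (-(s * (z + δ))) * Real.exp ((t + s) * Z r ω)
        + Real.exp (s * (z - δ)) * Real.exp ((t - s) * Z r ω) := fun ω => by
    have e1 : 0 < Real.exp (-(s * (z + δ))) * Real.exp ((t + s) * Z r ω) := by positivity
    have e2 : 0 < Real.exp (s * (z - δ)) * Real.exp ((t - s) * Z r ω) := by positivity
    by_cases h : |Z r ω - z| < δ
    · rw [Set.indicator_of_mem (by exact h)]
      have : Real.exp (t * Z r ω) ≤ Real.exp (t * z + |t| * δ) := by
        refine Real.exp_le_exp.2 ?_
        have h' : t * (Z r ω - z) ≤ |t| * δ := by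
          refine (le_abs_self _).trans ?_
          rw [abs_mul]
          gcongr
        linarith
      linarith
    · rw [Set.indicator_of_notMem (by exact h), zero_add]
      rcases le_abs.1 (not_lt.1 h) with h | h
      · have : Real.exp (t * Z r ω) ≤ Real.exp (-(s * (z + δ))) * Real.exp ((t + s) * Z r ω) := by
          rw [← Real.exp_add]
          refine Real.exp_le_exp.2 ?_
          nlinarith
        linarith
      · have : Real.exp (t * Z r ω) ≤ Real.exp (s * (z - δ)) * Real.exp ((t - s) * Z r ω) := by
          rw [← Real.exp_add]
          refine Real.exp_le_exp.2 ?_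
          nlinarith
        linarith
  have hnull : NullMeasurableSet {ω | |Z r ω - z| < δ} P :=
    nullMeasurableSet_lt (by fun_prop) aemeasurable_const
  have hind : Integrable
      (Set.indicator {ω | |Z r ω - z| < δ} (fun _ => Real.exp (t * z + |t| * δ))) P :=
    (integrable_const _).indicator₀ hnull
  have hbound : mgf (Z r) P t ≤ P.real {ω | |Z r ω - z| < δ} * Real.exp (t * z + |t| * δ)
      + Real.exp (-(s * (z + δ))) * mgf (Z r) P (t + s)
      + Real.exp (s * (z - δ)) * mgf (Z r) P (t - s) := by
    have hi2' := hi2.const_mul (Real.exp (-(s * (z + δ))))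
    have hi3' := hi3.const_mul (Real.exp (s * (z - δ)))
    refine (integral_mono hi1 ((hind.add hi2').add hi3') hpt).trans (le_of_eq ?_)
    rw [integral_add' (hind.add hi2') hi3', integral_add' hind hi2', integral_const_mul,
      integral_const_mul, integral_indicator₀ hnull, setIntegral_const, smul_eq_mul]
    rfl
  rw [← exp_cgf hi1, ← exp_cgf hi2, ← exp_cgf hi3, ← Real.exp_add, ← Real.exp_add] at hbound
  have hq : ∀ y, ε r * y + ε r * Real.log 4 < ε r * cgf (Z r) P t →
      Real.exp y ≤ Real.exp (cgf (Z r) P t) / 4 := fun y hy => by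
    rw [← Real.exp_log (show (0 : ℝ) < 4 by norm_num), ← Real.exp_sub]
    refine Real.exp_le_exp.2 ?_
    rw [← mul_add, mul_lt_mul_iff_right₀ hr] at hy
    linarith
  have hq1 := hq (-(s * (z + δ)) + cgf (Z r) P (t + s)) (by
    have : ε r * (-(s * (z + δ)) + cgf (Z r) P (t + s))
      = -(ε r * s * (z + δ)) + ε r * cgf (Z r) P (t + s) := by ring
    rw [this, hεs]; exact h1)
  have hq2 := hq (s * (z - δ) + cgf (Z r) P (t - s)) (by
    have : ε r * (s * (z - δ) + cgf (Z r) P (t - s))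
      = ε r * s * (z - δ) + ε r * cgf (Z r) P (t - s) := by ring
    rw [this, hεs]; exact h2)
  have hfin : Real.exp (cgf (Z r) P t) / 2
      ≤ P.real {ω | |Z r ω - z| < δ} * Real.exp (t * z + |t| * δ) := by linarith
  rw [← div_le_iff₀ (Real.exp_pos _)] at hfin
  refine le_trans ?_ hfin
  have e2 : Real.exp (cgf (Z r) P t) / 2 = Real.exp (cgf (Z r) P t - Real.log 2) := by
    rw [Real.exp_sub, Real.exp_log two_pos]
  rw [e2, ← Real.exp_sub]
  refine Real.exp_le_exp.2 ?_
  rw [div_le_iff₀ hr]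
  have hεt' : ε r * |t| = |z| / v := by
    have h := congrArg abs hεt
    rw [abs_mul, abs_of_pos hr] at h
    rw [h, abs_div, abs_of_pos hv]
  have e3 : (cgf (Z r) P t - Real.log 2 - (t * z + |t| * δ)) * ε r
      = ε r * cgf (Z r) P t - ε r * Real.log 2 - ε r * t * z - ε r * |t| * δ := by ring
  have e4 : z / v * z = z ^ 2 / v := by ring
  have e5 : |z| / v * δ = |z| * δ / v := by ring
  rw [e3, hεt, hεt', e4, e5]
  exact h3.le

lemma coe_ofReal_sq_div (hv : 0 < v) (z : ℝ) :
    ((ENNReal.ofReal (z ^ 2 / (2 * v)) : ℝ≥0∞) : EReal) = ((z ^ 2 / (2 * v) : ℝ) : EReal) := by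
  rw [EReal.coe_ennreal_ofReal, max_eq_left (by positivity)]

/-- If the scaled cumulant generating functions converge to those of a centered Gaussian law, the
large deviation principle holds with a quadratic rate function. -/
theorem satisfiesLDP_of_tendsto_cgf (hv : 0 < v) (hε : ∀ᶠ r in atTop, 0 < ε r)
    (hε0 : Tendsto ε atTop (𝓝 0)) (hZ : ∀ᶠ r in atTop, AEMeasurable (Z r) P)
    (hint : ∀ θ, ∀ᶠ r in atTop, Integrable (fun ω => Real.exp (θ / ε r * Z r ω)) P)
    (hlim : ∀ θ, Tendsto (fun r => ε r * cgf (Z r) P (θ / ε r)) atTop (𝓝 (v * θ ^ 2 / 2))) :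
    SatisfiesLDP P Z (fun r => 1 / ε r) fun z => ENNReal.ofReal (z ^ 2 / (2 * v)) where
  tendsto_speed := by
    simp_rw [one_div]
    exact tendsto_inv_nhdsGT_zero.comp (tendsto_nhdsWithin_iff.2 ⟨hε0, hε⟩)
  lowerSemicontinuous := by
    refine Continuous.lowerSemicontinuous (ENNReal.continuous_ofReal.comp ?_)
    fun_prop
  upper_bound F _ := by
    rw [← EReal.le_of_forall_lt_iff_le]
    intro c hc
    simp only [one_div_one_div]
    refine limsup_le_of_le (by isBoundedDefault) ?_
    rw [EReal.neg_lt_comm] at hc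
    -- A positive level is trivial, since logarithms of probabilities are nonpositive.
    rcases lt_or_ge 0 c with hc0 | hc0
    · filter_upwards [hε] with r hr
      have h1 : ENNReal.log (P {ω | Z r ω ∈ F}) ≤ 0 := ENNReal.log_le_zero_iff.2 prob_le_one
      calc ((ε r : ℝ) : EReal) * ENNReal.log (P {ω | Z r ω ∈ F})
          ≤ ((ε r : ℝ) : EReal) * 0 := mul_le_mul_of_nonneg_left h1 (by exact_mod_cast hr.le)
        _ ≤ c := by rw [mul_zero]; exact_mod_cast hc0.le
    obtain ⟨c', hc1, hc2⟩ := EReal.lt_iff_exists_real_btwn.1 hc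
    have hcc : -c < c' := by exact_mod_cast hc1
    have hc'0 : 0 ≤ 2 * v * c' := by nlinarith
    -- The radius at which the rate equals `c'`; it puts `F` inside two half-lines.
    set m := Real.sqrt (2 * v * c') with hm
    have hm2 : m ^ 2 / (2 * v) = c' := by rw [hm, Real.sq_sqrt hc'0]; field_simp
    have hF : ∀ z ∈ F, m ≤ |z| := fun z hz => by
      have : (c' : EReal) < ((z ^ 2 / (2 * v) : ℝ) : EReal) := by
        rw [← coe_ofReal_sq_div hv]
        exact hc2.trans_le (iInf₂_le z hz)
      have : c' < z ^ 2 / (2 * v) := by exact_mod_cast this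
      rw [lt_div_iff₀ (by positivity)] at this
      rw [hm, ← Real.sqrt_sq_eq_abs]
      exact Real.sqrt_le_sqrt (by linarith)
    -- Half of the gap between `-c'` and `c` pays for the Chernoff error, half for the factor 2 of
    -- the union bound.
    set η := (c' + c) / 2 with hη
    have hη0 : 0 < η := by rw [hη]; linarith
    have hlog : ∀ᶠ r in atTop, ε r * Real.log 2 < η := by
      have : Tendsto (fun r => ε r * Real.log 2) atTop (𝓝 0) := by
        simpa using hε0.mul_const (Real.log 2)
      exact this.eventually_lt_const hη0
    filter_upwards [hε, hlog, eventually_measureReal_ge_le_exp hv hε hint hlim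
      (Real.sqrt_nonneg (2 * v * c')) hη0, eventually_measureReal_le_le_exp hv hε hint hlim
      (Real.sqrt_nonneg (2 * v * c')) hη0] with r hr hl h1 h2
    rw [← hm, hm2] at h1 h2
    have hsub : {ω | Z r ω ∈ F} ⊆ {ω | m ≤ Z r ω} ∪ {ω | Z r ω ≤ -m} := fun ω hω => by
      rcases le_abs.1 (hF _ hω) with h | h
      · exact Or.inl h
      · exact Or.inr (le_neg.1 h)
    have hP : P {ω | Z r ω ∈ F} ≤ ENNReal.ofReal (2 * Real.exp ((-c' + η) / ε r)) := by
      rw [← ofReal_measureReal (measure_ne_top _ _)]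
      refine ENNReal.ofReal_le_ofReal ?_
      refine (measureReal_mono hsub).trans ((measureReal_union_le _ _).trans ?_)
      linarith
    have hlogP := ENNReal.log_le_log hP
    rw [ENNReal.log_ofReal_of_pos (by positivity)] at hlogP
    refine (mul_le_mul_of_nonneg_left hlogP (by exact_mod_cast hr.le)).trans ?_
    rw [Real.log_mul (by norm_num) (Real.exp_ne_zero _), Real.log_exp]
    have : ε r * (Real.log 2 + (-c' + η) / ε r) ≤ c := by
      rw [mul_add, mul_div_cancel₀ _ hr.ne']
      linarith
    exact_mod_cast this
  lower_bound G hG := by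
    rw [EReal.neg_le]
    refine le_iInf₂ fun z hz => ?_
    rw [EReal.neg_le, coe_ofReal_sq_div hv, ← EReal.coe_neg, ← EReal.ge_of_forall_gt_iff_ge]
    intro c hc
    have hc' : c < -(z ^ 2 / (2 * v)) := by exact_mod_cast hc
    simp only [one_div_one_div]
    refine le_liminf_of_le (by isBoundedDefault) ?_
    obtain ⟨δ, hδ, hball⟩ := Metric.isOpen_iff.1 hG z hz
    set η := -(z ^ 2 / (2 * v)) - c with hη
    have hη0 : 0 < η := by linarith
    obtain ⟨δ', hδ', hδδ, hδη⟩ : ∃ δ' > 0, δ' ≤ δ ∧ |z| * δ' / v < η := by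
      have h : Tendsto (fun t : ℝ => |z| * t / v) (𝓝[>] 0) (𝓝 0) := by
        have : Continuous fun t : ℝ => |z| * t / v := by fun_prop
        simpa using (this.tendsto 0).mono_left nhdsWithin_le_nhds
      obtain ⟨t, h1, h2⟩ := ((h.eventually_lt_const hη0).and
        (Ioc_mem_nhdsGT hδ)).exists
      exact ⟨t, h2.1, h2.2, h1⟩
    filter_upwards [hε, eventually_exp_le_measureReal_abs_sub_lt hv hε hε0 hZ hint hlim hδ' hδη]
      with r hr h1
    have hP : ENNReal.ofReal (Real.exp ((-(z ^ 2 / (2 * v)) - η) / ε r)) ≤ P {ω | Z r ω ∈ G} := by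
      rw [← ofReal_measureReal (measure_ne_top _ _)]
      refine ENNReal.ofReal_le_ofReal (h1.trans (measureReal_mono fun ω hω => hball ?_))
      exact lt_of_lt_of_le hω hδδ
    have hlogP := ENNReal.log_le_log hP
    rw [ENNReal.log_ofReal_of_pos (by positivity), Real.log_exp] at hlogP
    refine le_trans ?_ (mul_le_mul_of_nonneg_left hlogP (by exact_mod_cast hr.le))
    have : c ≤ ε r * ((-(z ^ 2 / (2 * v)) - η) / ε r) := by
      rw [mul_div_cancel₀ _ hr.ne', hη]
      linarith
    exact_mod_cast this

lemma isGoodRateFunction_sq_div (hv : 0 < v) :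
    IsGoodRateFunction fun z : ℝ => ENNReal.ofReal (z ^ 2 / (2 * v)) := by
  intro η
  have hclosed : IsClosed {z : ℝ | ENNReal.ofReal (z ^ 2 / (2 * v)) ≤ η} :=
    isClosed_le (ENNReal.continuous_ofReal.comp (by fun_prop)) continuous_const
  refine isCompact_Icc.of_isClosed_subset (s := Set.Icc (-Real.sqrt (2 * v * η))
    (Real.sqrt (2 * v * η))) hclosed fun z hz => ?_
  beta_reduce at hz
  rw [Set.mem_ofPred_eq, ← ENNReal.ofReal_coe_nnreal, ENNReal.ofReal_le_ofReal_iff η.coe_nonneg,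
    div_le_iff₀ (by positivity)] at hz
  exact abs_le.1 (Real.abs_le_sqrt (by linarith))

end GartnerEllis

/-! ### The exponent of the moment generating function -/

/-- Measuring time in units of `1 / mu` reduces the rates to `β` and 1. -/
lemma telegraphLambda_scale {mu : ℝ} (hmu : 0 < mu) (s β : ℝ) :
    telegraphLambda (mu * s) (β * mu) mu = mu * telegraphLambda s β 1 := by
  unfold telegraphLambda
  rw [show (β * mu + mu - 2 * (mu * s)) ^ 2 - 4 * (β * mu) * mu
    = mu ^ 2 * ((β + 1 - 2 * s) ^ 2 - 4 * β * 1) by ring, Real.sqrt_mul (sq_nonneg _),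
    Real.sqrt_sq hmu.le]
  ring

lemma telegraphLambda_zero {β : ℝ} (hβ : 1 < β) : telegraphLambda 0 β 1 = 0 := by
  unfold telegraphLambda
  rw [show (β + 1 - 2 * 0) ^ 2 - 4 * β * 1 = (β - 1) ^ 2 by ring,
    Real.sqrt_sq (sub_pos.2 hβ).le]
  ring

lemma hasDerivAt_telegraphLambda {s β : ℝ} (h : 0 < (β + 1 - 2 * s) ^ 2 - 4 * β * 1) :
    HasDerivAt (fun s => telegraphLambda s β 1)
      ((β + 1 - 2 * s) / Real.sqrt ((β + 1 - 2 * s) ^ 2 - 4 * β * 1)) s := by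
  have h1 : HasDerivAt (fun s : ℝ => (β + 1 - 2 * s) ^ 2 - 4 * β * 1)
      (2 * (β + 1 - 2 * s) * (-2)) s := by
    have := ((((hasDerivAt_id s).const_mul 2).const_sub (β + 1)).pow 2).sub_const (4 * β * 1)
    convert! this using 1
    simp
  have h2 := ((h1.sqrt h.ne').const_sub (β - 1)).div_const 2
  convert! h2 using 1
  have := (Real.sqrt_pos.2 h).ne'
  field_simp

lemma eventually_discriminant_pos {β : ℝ} (hβ : 1 < β) :
    ∀ᶠ s : ℝ in 𝓝 0, 0 < (β + 1 - 2 * s) ^ 2 - 4 * β * 1 := by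
  have hc : Continuous fun s : ℝ => (β + 1 - 2 * s) ^ 2 - 4 * β * 1 := by fun_prop
  refine hc.continuousAt.eventually (eventually_gt_nhds ?_)
  nlinarith [sq_pos_of_pos (sub_pos.2 hβ)]

lemma hasDerivAt_telegraphLambda_zero {β : ℝ} (hβ : 1 < β) :
    HasDerivAt (fun s => telegraphLambda s β 1) ((β + 1) / (β - 1)) 0 := by
  have h := hasDerivAt_telegraphLambda (eventually_discriminant_pos hβ).self_of_nhds
  convert! h using 1
  rw [show (β + 1 - 2 * 0) ^ 2 - 4 * β * 1 = (β - 1) ^ 2 by ring,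
    Real.sqrt_sq (sub_pos.2 hβ).le]
  ring

lemma telegraphLambdaSecond_eq {β : ℝ} (hβ : 1 < β) :
    telegraphLambdaSecond β 1 = 8 * β / (β - 1) ^ 3 := by
  have hβ' : 0 < β - 1 := sub_pos.2 hβ
  have h0 := (eventually_discriminant_pos hβ).self_of_nhds
  have hq : Real.sqrt ((β + 1 - 2 * 0) ^ 2 - 4 * β * 1) = β - 1 := by
    rw [show (β + 1 - 2 * 0) ^ 2 - 4 * β * 1 = (β - 1) ^ 2 by ring, Real.sqrt_sq hβ'.le]
  have hderiv : deriv (fun s => telegraphLambda s β 1) =ᶠ[𝓝 0]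
      fun s => (β + 1 - 2 * s) / Real.sqrt ((β + 1 - 2 * s) ^ 2 - 4 * β * 1) :=
    (eventually_discriminant_pos hβ).mono fun s hs => (hasDerivAt_telegraphLambda hs).deriv
  have h1 : HasDerivAt (fun s : ℝ => β + 1 - 2 * s) (-2) 0 := by
    simpa using ((hasDerivAt_id (0 : ℝ)).const_mul 2).const_sub (β + 1)
  have h2 := ((h1.pow 2).sub_const (4 * β * 1)).sqrt h0.ne'
  have h3 := h1.fun_div h2 (by simp only [Pi.pow_apply]; rw [hq]; exact hβ'.ne')
  unfold telegraphLambdaSecond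
  rw [iteratedDeriv_succ, iteratedDeriv_one, hderiv.deriv_eq]
  refine h3.deriv.trans ?_
  simp only [Pi.pow_apply, hq]
  field_simp
  ring

/-- The second order expansion of `Λ(·; β, 1)` at the origin. -/
lemma exists_telegraphLambda_eq {β : ℝ} (hβ : 1 < β) :
    ∃ k : ℝ → ℝ, Tendsto k (𝓝 0) (𝓝 (telegraphLambdaSecond β 1 / 2)) ∧
      ∀ᶠ s in 𝓝 0, telegraphLambda s β 1 - s * ((β + 1) / (β - 1)) = s ^ 2 * k s := by
  have hβ' : 0 < β - 1 := sub_pos.2 hβ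
  -- Conjugate of twice the difference to be expanded: with `p = β - 1 - 2 s (β + 1) / (β - 1)` and
  -- `q` the square root, `p² - q² = 16 β s² / (β - 1)²`.
  let den : ℝ → ℝ := fun s => β - 1 - 2 * s * ((β + 1) / (β - 1)) +
    Real.sqrt ((β + 1 - 2 * s) ^ 2 - 4 * β * 1)
  have hden : Continuous den := by unfold den; fun_prop
  have hden0 : den 0 = 2 * (β - 1) := by
    simp only [den]
    rw [show (β + 1 - 2 * 0) ^ 2 - 4 * β * 1 = (β - 1) ^ 2 by ring, Real.sqrt_sq hβ'.le]
    ring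
  have hpos : ∀ᶠ s in 𝓝 0, 0 < den s :=
    hden.continuousAt.eventually (eventually_gt_nhds (by rw [hden0]; positivity))
  refine ⟨fun s => 8 * β / (β - 1) ^ 2 / den s, ?_, ?_⟩
  · have h := (tendsto_const_nhds (x := 8 * β / (β - 1) ^ 2)).div (hden.tendsto 0)
      (by rw [hden0]; positivity)
    rw [hden0] at h
    have h2 : telegraphLambdaSecond β 1 / 2 = 8 * β / (β - 1) ^ 2 / (2 * (β - 1)) := by
      rw [telegraphLambdaSecond_eq hβ]
      field_simp
    rw [h2]
    exact h
  · filter_upwards [hpos, eventually_discriminant_pos hβ] with s hs hd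
    have hsq := Real.sq_sqrt hd.le
    rw [← mul_div_assoc (s ^ 2), eq_div_iff hs.ne']
    simp only [den, telegraphLambda]
    set q := Real.sqrt ((β + 1 - 2 * s) ^ 2 - 4 * β * 1)
    field_simp
    linear_combination (-(β - 1) ^ 2) * hsq

/-! ### Moderate deviations of the absorption time -/

/-- As `M` is nonnegative, integrability at one positive exponent passes to all smaller ones,
including the negative ones. -/
lemma IsLightTailedCount.zero_mem_interior_integrableExpSet {Ω : Type*} [MeasurableSpace Ω]
    {P : Measure Ω} {M : Ω → ℕ} (hM : IsLightTailedCount P M) :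
    0 ∈ interior (integrableExpSet (fun ω => (M ω : ℝ)) P) := by
  obtain ⟨s, hs, hi⟩ := hM.light_tail
  have hm : AEMeasurable (fun ω => (M ω : ℝ)) P :=
    (measurable_of_countable _).comp_aemeasurable hM.aemeasurable
  rw [mem_interior_iff_mem_nhds]
  refine Filter.mem_of_superset (Iio_mem_nhds hs) fun t ht => ?_
  refine hi.mono' (AEMeasurable.aestronglyMeasurable (by fun_prop)) (ae_of_all _ fun ω => ?_)
  rw [Real.norm_eq_abs, Real.abs_exp]
  exact Real.exp_le_exp.2 (mul_le_mul_of_nonneg_right (le_of_lt ht) (Nat.cast_nonneg _))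

/-- The moment generating function of the duration of an excursion from the origin, in the time
scale of the downward phases. -/
noncomputable def excursionMGF (β s : ℝ) : ℝ := 1 - s + telegraphLambda s β 1

/-- The moment generating function of the total duration of as many independent excursions from the
origin as there are visits, in the time scale of the downward phases. -/
noncomputable def visitsMGF {Ω : Type*} [MeasurableSpace Ω] (P : Measure Ω) (M : Ω → ℕ)
    (β s : ℝ) : ℝ := mgf (fun ω => (M ω : ℝ)) P (Real.log (excursionMGF β s))

section ModerateDeviations

variable {Ω : Type*} [MeasurableSpace Ω] {P : Measure Ω} [IsProbabilityMeasure P]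
  {M : Ω → ℕ} {β x mu : ℝ} {U D : ℕ → ℕ → Ω → ℝ}

lemma excursionMGF_zero {β : ℝ} (hβ : 1 < β) : excursionMGF β 0 = 1 := by
  simp [excursionMGF, telegraphLambda_zero hβ]

lemma visitsMGF_zero (hβ : 1 < β) : visitsMGF P M β 0 = 1 := by
  simp [visitsMGF, excursionMGF_zero hβ]

lemma differentiableAt_excursionMGF_zero (hβ : 1 < β) :
    DifferentiableAt ℝ (excursionMGF β) 0 :=
  ((differentiableAt_const 1).sub differentiableAt_id).add
    (hasDerivAt_telegraphLambda_zero hβ).differentiableAt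

lemma differentiableAt_log_excursionMGF_zero (hβ : 1 < β) :
    DifferentiableAt ℝ (fun s => Real.log (excursionMGF β s)) 0 :=
  (differentiableAt_excursionMGF_zero hβ).log (by rw [excursionMGF_zero hβ]; exact one_ne_zero)

lemma differentiableAt_visitsMGF_zero {P : Measure Ω} (hβ : 1 < β) (hM : IsLightTailedCount P M) :
    DifferentiableAt ℝ (visitsMGF P M β) 0 := by
  refine DifferentiableAt.fun_comp' (0 : ℝ)
    (g := mgf (fun ω => (M ω : ℝ)) P) ?_ (differentiableAt_log_excursionMGF_zero hβ)
  rw [excursionMGF_zero hβ, Real.log_one]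
  exact differentiableAt_mgf hM.zero_mem_interior_integrableExpSet

lemma integrable_exp_absorptionTime_and_mgf_eq {s : ℝ} (hβ : 1 < β) (hx : 0 ≤ x) (hmu : 0 < mu)
    (hM : IsLightTailedCount P M) (h : IsTelegraphModel P (β * mu) mu M U D)
    (hs : 0 < β + 1 - 2 * s) (hdisc : 0 < (β + 1 - 2 * s) ^ 2 - 4 * β * 1)
    (hφ : 0 < excursionMGF β s)
    (hi : Integrable (fun ω => Real.exp (Real.log (excursionMGF β s) * M ω)) P) :
    Integrable (fun ω => Real.exp (mu * s * absorptionTime x M U D ω)) P ∧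
      mgf (absorptionTime x M U D) P (mu * s)
        = Real.exp (x * mu * telegraphLambda s β 1) * visitsMGF P M β s := by
  have hlt : mu < β * mu := by nlinarith
  have hl := lintegral_exp_absorptionTime (s := mu * s) h hM hmu hlt
    (by nlinarith [mul_pos hmu hs]) (by nlinarith [mul_pos (mul_pos hmu hmu) hdisc]) hx
  have hφ' : (mu - mu * s + telegraphLambda (mu * s) (β * mu) mu) / mu = excursionMGF β s := by
    rw [telegraphLambda_scale hmu, excursionMGF]
    field_simp
  have hpow : ∀ ω, excursionMGF β s ^ M ω = Real.exp (Real.log (excursionMGF β s) * M ω) :=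
    fun ω => by rw [← Real.rpow_natCast, Real.rpow_def_of_pos hφ]
  rw [hφ', telegraphLambda_scale hmu, ← mul_assoc] at hl
  simp_rw [hpow] at hl
  rw [← ofReal_integral_eq_lintegral_ofReal hi (ae_of_all _ fun ω => (Real.exp_pos _).le),
    ← ENNReal.ofReal_mul (Real.exp_pos _).le] at hl
  have hmeas : AEStronglyMeasurable
      (fun ω => Real.exp (mu * s * absorptionTime x M U D ω)) P := by
    have := aemeasurable_absorptionTime h hM hmu hlt hx
    exact AEMeasurable.aestronglyMeasurable (by fun_prop)
  have hnonneg : 0 ≤ᵐ[P] fun ω => Real.exp (mu * s * absorptionTime x M U D ω) :=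
    ae_of_all _ fun ω => (Real.exp_pos _).le
  refine ⟨(lintegral_ofReal_ne_top_iff_integrable hmeas hnonneg).1
    (by rw [hl]; exact ENNReal.ofReal_ne_top), ?_⟩
  rw [mgf, integral_eq_lintegral_of_nonneg_ae hnonneg hmeas, hl, ENNReal.toReal_ofReal
    (mul_nonneg (Real.exp_pos _).le (integral_nonneg fun ω => (Real.exp_pos _).le))]
  rfl

/-- The neighbourhood of `s = 0` is the same for all `μ`; this allows `s` to be replaced later by a
quantity that depends on `μ` and tends to zero. -/
lemma eventually_integrable_exp_absorptionTime_and_mgf_eq (hβ : 1 < β) (hx : 0 ≤ x)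
    (hM : IsLightTailedCount P M) {U D : ℝ → ℕ → ℕ → Ω → ℝ}
    (hmodel : ∀ μ : ℝ, 0 < μ → IsTelegraphModel P (β * μ) μ M (U μ) (D μ)) :
    ∀ᶠ s : ℝ in 𝓝 0, ∀ μ : ℝ, 0 < μ →
      Integrable (fun ω => Real.exp (μ * s * absorptionTime x M (U μ) (D μ) ω)) P ∧
      mgf (absorptionTime x M (U μ) (D μ)) P (μ * s)
        = Real.exp (x * μ * telegraphLambda s β 1) * visitsMGF P M β s := by
  have h1 : ∀ᶠ s : ℝ in 𝓝 0, 0 < β + 1 - 2 * s := by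
    have hc : Continuous fun s : ℝ => β + 1 - 2 * s := by fun_prop
    exact hc.continuousAt.eventually (eventually_gt_nhds (by linarith))
  have h2 : ∀ᶠ s : ℝ in 𝓝 0, 0 < excursionMGF β s :=
    (differentiableAt_excursionMGF_zero hβ).continuousAt.eventually
      (eventually_gt_nhds (by rw [excursionMGF_zero hβ]; exact one_pos))
  have h3 : ∀ᶠ s : ℝ in 𝓝 0,
      Integrable (fun ω => Real.exp (Real.log (excursionMGF β s) * M ω)) P := by
    have hmem := mem_interior_iff_mem_nhds.1 hM.zero_mem_interior_integrableExpSet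
    have hc := (differentiableAt_log_excursionMGF_zero hβ).continuousAt
    rw [ContinuousAt, excursionMGF_zero hβ, Real.log_one] at hc
    exact hc.eventually hmem
  filter_upwards [h1, h2, h3, eventually_discriminant_pos hβ] with s hs1 hs2 hs3 hs4 μ hμ
  exact integrable_exp_absorptionTime_and_mgf_eq hβ hx hμ hM (hmodel μ hμ) hs1 hs4 hs2 hs3

/-- The absorption time is integrable; its mean is given by the derivatives of the exponents. -/
lemma integrable_absorptionTime_and_integral_eq (hβ : 1 < β) (hx : 0 ≤ x)
    (hM : IsLightTailedCount P M) {U D : ℝ → ℕ → ℕ → Ω → ℝ}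
    (hmodel : ∀ μ : ℝ, 0 < μ → IsTelegraphModel P (β * μ) μ M (U μ) (D μ)) {μ : ℝ} (hμ : 0 < μ) :
    Integrable (absorptionTime x M (U μ) (D μ)) P ∧
      ∫ ω, absorptionTime x M (U μ) (D μ) ω ∂P
        = x * ((β + 1) / (β - 1)) + deriv (visitsMGF P M β) 0 / μ := by
  have hev := eventually_integrable_exp_absorptionTime_and_mgf_eq hβ hx hM hmodel
  have hscale : Tendsto (fun s : ℝ => s / μ) (𝓝 0) (𝓝 0) := by
    have : Continuous fun s : ℝ => s / μ := by fun_prop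
    simpa using this.tendsto 0
  have hev' : ∀ᶠ s : ℝ in 𝓝 0,
      s ∈ integrableExpSet (absorptionTime x M (U μ) (D μ)) P ∧
      mgf (absorptionTime x M (U μ) (D μ)) P s
        = Real.exp (x * μ * telegraphLambda (s / μ) β 1) * visitsMGF P M β (s / μ) := by
    filter_upwards [hscale.eventually hev] with s hs
    have := hs μ hμ
    rwa [mul_div_cancel₀ _ hμ.ne'] at this
  have h0 : (0 : ℝ) ∈ interior (integrableExpSet (absorptionTime x M (U μ) (D μ)) P) :=
    mem_interior_iff_mem_nhds.2 (hev'.mono fun s hs => hs.1)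
  refine ⟨integrable_of_mem_interior_integrableExpSet h0, ?_⟩
  have heq : mgf (absorptionTime x M (U μ) (D μ)) P =ᶠ[𝓝 0] fun s =>
      Real.exp (x * μ * telegraphLambda (s / μ) β 1) * visitsMGF P M β (s / μ) :=
    hev'.mono fun s hs => hs.2
  rw [← deriv_mgf_zero h0, heq.deriv_eq]
  have hdiv : HasDerivAt (fun s : ℝ => s / μ) (1 / μ) 0 := (hasDerivAt_id _).div_const μ
  have hz : (0 : ℝ) / μ = 0 := zero_div μ
  have hΛ : HasDerivAt (fun s => telegraphLambda (s / μ) β 1)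
      ((β + 1) / (β - 1) * (1 / μ)) 0 := by
    refine HasDerivAt.comp (h₂ := fun s => telegraphLambda s β 1) 0 ?_ hdiv
    rw [hz]
    exact hasDerivAt_telegraphLambda_zero hβ
  have hψ : HasDerivAt (fun s => visitsMGF P M β (s / μ))
      (deriv (visitsMGF P M β) 0 * (1 / μ)) 0 := by
    refine HasDerivAt.comp (h₂ := visitsMGF P M β) 0 ?_ hdiv
    rw [hz]
    exact (differentiableAt_visitsMGF_zero hβ hM).hasDerivAt
  refine (((hΛ.const_mul (x * μ)).exp).fun_mul hψ).deriv.trans ?_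
  rw [hz, telegraphLambda_zero hβ, visitsMGF_zero hβ, mul_zero, Real.exp_zero]
  field_simp

/-- The scaled cumulant generating functions of the centered absorption times. -/
lemma tendsto_cgf_absorptionTime (hβ : 1 < β) (hx : 0 ≤ x)
    (hM : IsLightTailedCount P M) {U D : ℝ → ℕ → ℕ → Ω → ℝ}
    (hmodel : ∀ μ : ℝ, 0 < μ → IsTelegraphModel P (β * μ) μ M (U μ) (D μ))
    {ε : ℝ → ℝ} (hε_pos : ∀ μ : ℝ, 0 < μ → 0 < ε μ) (hε : Tendsto ε atTop (𝓝 0))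
    (hμε : Tendsto (fun μ => μ * ε μ) atTop atTop) (θ : ℝ) :
    (∀ᶠ μ in atTop, Integrable (fun ω => Real.exp (θ / ε μ * (Real.sqrt (μ * ε μ) *
        (absorptionTime x M (U μ) (D μ) ω - ∫ ω', absorptionTime x M (U μ) (D μ) ω' ∂P)))) P) ∧
      Tendsto (fun μ => ε μ * cgf (fun ω => Real.sqrt (μ * ε μ) *
        (absorptionTime x M (U μ) (D μ) ω - ∫ ω', absorptionTime x M (U μ) (D μ) ω' ∂P)) P
          (θ / ε μ)) atTop (𝓝 (x * telegraphLambdaSecond β 1 * θ ^ 2 / 2)) := by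
  -- The tilt `θ / ε` of the rescaled variable is the tilt `μ δ` of the absorption time.
  let δ : ℝ → ℝ := fun μ => θ / Real.sqrt (μ * ε μ)
  have hδ : Tendsto δ atTop (𝓝 0) :=
    tendsto_const_nhds.div_atTop (Real.tendsto_sqrt_atTop.comp hμε)
  have hev := hδ.eventually (eventually_integrable_exp_absorptionTime_and_mgf_eq hβ hx hM hmodel)
  have hscale : ∀ μ, 0 < μ → Real.sqrt (μ * ε μ) * (θ / ε μ) = μ * δ μ := fun μ hμ => by
    have hpos := mul_pos hμ (hε_pos μ hμ)
    have h1 := Real.mul_self_sqrt hpos.le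
    have h2 := (Real.sqrt_pos.2 hpos).ne'
    have h3 := (hε_pos μ hμ).ne'
    simp only [δ]
    field_simp
    linear_combination θ * h1
  have hψcont := (differentiableAt_visitsMGF_zero (P := P) (M := M) hβ hM).continuousAt
  have hψpos : ∀ᶠ s in 𝓝 0, 0 < visitsMGF P M β s :=
    hψcont.eventually (eventually_gt_nhds (by rw [visitsMGF_zero hβ]; exact one_pos))
  obtain ⟨k, hk, hkeq⟩ := exists_telegraphLambda_eq hβ
  refine ⟨?_, ?_⟩
  · filter_upwards [hev, eventually_gt_atTop 0] with μ h hμ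
    have h1 := (h μ hμ).1.mul_const
      (Real.exp (-(μ * δ μ * ∫ ω', absorptionTime x M (U μ) (D μ) ω' ∂P)))
    refine h1.congr (ae_of_all _ fun ω => ?_)
    beta_reduce
    rw [← Real.exp_add, ← hscale μ hμ]
    ring_nf
  -- What remains of the scaled cumulant generating function once the mean has cancelled the linear
  -- term of `Λ`.
  · have hlim : Tendsto (fun μ => x * (θ ^ 2 * k (δ μ)) + ε μ * (Real.log (visitsMGF P M β (δ μ))
        - δ μ * deriv (visitsMGF P M β) 0)) atTop
        (𝓝 (x * (θ ^ 2 * (telegraphLambdaSecond β 1 / 2)) + 0 * (Real.log 1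
          - 0 * deriv (visitsMGF P M β) 0))) := by
      have hlog : Tendsto (fun μ => Real.log (visitsMGF P M β (δ μ))) atTop (𝓝 (Real.log 1)) := by
        rw [ContinuousAt, visitsMGF_zero hβ] at hψcont
        exact (hψcont.comp hδ).log one_ne_zero
      exact (((hk.comp hδ).const_mul _).const_mul x).add
        (hε.mul (hlog.sub (hδ.mul_const _)))
    have hgoal : x * (θ ^ 2 * (telegraphLambdaSecond β 1 / 2)) + 0 * (Real.log 1
        - 0 * deriv (visitsMGF P M β) 0) = x * telegraphLambdaSecond β 1 * θ ^ 2 / 2 := by ring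
    rw [hgoal] at hlim
    refine hlim.congr' ?_
    filter_upwards [hev, eventually_gt_atTop 0, hδ.eventually hkeq, hδ.eventually hψpos]
      with μ h hμ hkμ hψμ
    have hpos := mul_pos hμ (hε_pos μ hμ)
    have hδ2 : μ * ε μ * δ μ ^ 2 = θ ^ 2 := by
      simp only [δ]
      rw [div_pow, Real.sq_sqrt hpos.le]
      exact mul_div_cancel₀ _ hpos.ne'
    have hcgf : cgf (fun ω => Real.sqrt (μ * ε μ) *
        (absorptionTime x M (U μ) (D μ) ω - ∫ ω', absorptionTime x M (U μ) (D μ) ω' ∂P)) P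
          (θ / ε μ) = x * μ * telegraphLambda (δ μ) β 1 + Real.log (visitsMGF P M β (δ μ))
            - μ * δ μ * ∫ ω', absorptionTime x M (U μ) (D μ) ω' ∂P := by
      simp_rw [sub_eq_add_neg]
      rw [cgf, mgf_const_mul, hscale μ hμ, mgf_add_const, (h μ hμ).2, Real.log_mul
        (mul_pos (Real.exp_pos _) hψμ).ne' (Real.exp_ne_zero _), Real.log_mul (Real.exp_ne_zero _)
        hψμ.ne', Real.log_exp, Real.log_exp]
      ring
    rw [hcgf, (integrable_absorptionTime_and_integral_eq hβ hx hM hmodel hμ).2]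
    have hμd : μ * (deriv (visitsMGF P M β) 0 / μ) = deriv (visitsMGF P M β) 0 :=
      mul_div_cancel₀ _ hμ.ne'
    linear_combination (-x * k (δ μ)) * hδ2 - (x * μ * ε μ) * hkμ + (ε μ * δ μ) * hμd

end ModerateDeviations
-- Moderate deviation principle for the absorption time.
theorem proposition4p2 {Ω : Type*} [MeasurableSpace Ω] (P : Measure Ω) [IsProbabilityMeasure P]
    (x β : ℝ) (hx : 0 < x) (hβ : 1 < β)
    (M : Ω → ℕ) (hM : IsLightTailedCount P M)
    (U D : ℝ → ℕ → ℕ → Ω → ℝ)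
    (hmodel : ∀ μ : ℝ, 0 < μ → IsTelegraphModel P (β * μ) μ M (U μ) (D μ))
    (ε : ℝ → ℝ) (hε_pos : ∀ μ : ℝ, 0 < μ → 0 < ε μ)
    (hε : Tendsto ε atTop (𝓝 0)) (hμε : Tendsto (fun μ => μ * ε μ) atTop atTop) :
    (∀ μ : ℝ, 0 < μ → Integrable (absorptionTime x M (U μ) (D μ)) P) ∧
    SatisfiesLDP P
      (fun μ ω => Real.sqrt (μ * ε μ) *
        (absorptionTime x M (U μ) (D μ) ω - ∫ ω', absorptionTime x M (U μ) (D μ) ω' ∂P))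
      (fun μ => 1 / ε μ)
      (fun z => ENNReal.ofReal (z ^ 2 / (2 * x * telegraphLambdaSecond β 1))) ∧
    IsGoodRateFunction
      (fun z : ℝ => ENNReal.ofReal (z ^ 2 / (2 * x * telegraphLambdaSecond β 1))) ∧
    telegraphLambdaSecond β 1 = 8 * β / (β - 1) ^ 3 := by
  have hpos : 0 < x * telegraphLambdaSecond β 1 := by
    have : 0 < β - 1 := sub_pos.2 hβ
    rw [telegraphLambdaSecond_eq hβ]
    positivity
  have hI : (fun z : ℝ => ENNReal.ofReal (z ^ 2 / (2 * x * telegraphLambdaSecond β 1)))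
      = fun z => ENNReal.ofReal (z ^ 2 / (2 * (x * telegraphLambdaSecond β 1))) := by
    simp_rw [mul_assoc]
  rw [hI]
  have hint := fun μ hμ => (integrable_absorptionTime_and_integral_eq hβ hx.le hM hmodel
    (μ := μ) hμ).1
  refine ⟨hint, ?_, isGoodRateFunction_sq_div hpos, telegraphLambdaSecond_eq hβ⟩
  -- The limiting Gaussian variance is `x Λ''(0; β, 1)`.
  refine satisfiesLDP_of_tendsto_cgf hpos ((eventually_gt_atTop 0).mono hε_pos) hε ?_
    (fun θ => (tendsto_cgf_absorptionTime hβ hx.le hM hmodel hε_pos hε hμε θ).1)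
    fun θ => (tendsto_cgf_absorptionTime hβ hx.le hM hmodel hε_pos hε hμε θ).2
  filter_upwards [eventually_gt_atTop 0] with μ hμ
  have := (hint μ hμ).aemeasurable
  fun_prop
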